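/- **Model.** Let $\phi:\mathbb R\to\mathbb R$ be a differentiable even function with $\{\phi\neq 0\}$ non-empty and contained in $(-R_x,R_x)$, and let $P_\xi$, $P_\kappa$ be Borel probability measures on $\mathbb R$ concentrated on $[-R_\xi,R_\xi]$ and $(0,R_\kappa]$ respectively, where $R_x,R_\xi,R_\kappa$ are positive constants. Let $\omega=\{(\tau,\eta,\xi,\kappa)\}$ be a Poisson point process on $\mathbb Z\times\mathbb R^3$ with driving measure $(\text{counting measure})\times(\text{Lebesgue measure})\times P_\xi\times P_\kappa$: it is a random locally finite configuration for which the numbers of points in disjoint bounded Borel sets are independent, and the number of points in a bounded Borel set is Poisson distributed with parameter equal to the driving measure of that set. Let $\mathsf E$ be the expectation with respect to its law, and put $$F_\omega(n,x)=\sum_{(n,\eta,\xi,\kappa)\in\omega}\xi\,\phi\Big(\frac{x-\eta}{\kappa}\Big),\qquad (n,x)\in\mathbb Z\times\mathbb R.$$ For $p\in[0,1]$, integers $n_0<n_1$ and $x,y\in\mathbb R$ let $$A_\omega^{n_0,n_1}(x,y)=\min_\gamma\Big\{\frac12\sum_{k=n_0}^{n_1-1}(\gamma_{k+1}-\gamma_k)^2+pF_\omega(n_0,\gamma_{n_0})+\sum_{k=n_0+1}^{n_1-1}F_\omega(k,\gamma_k)+(1-p)F_\omega(n_1,\gamma_{n_1})\Big\},$$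 the minimum being over all $\gamma=(\gamma_{n_0},\dots,\gamma_{n_1})\in\mathbb R^{\{n_0,\dots,n_1\}}$ with $\gamma_{n_0}=x$, $\gamma_{n_1}=y$. **Statement.** Let $p\in[0,1]$ and $v\in\mathbb R$. For every $n\ge1$ the minimum defining $A^{0,n}(0,vn)$ is almost surely attained and $\mathsf E|A^{0,n}(0,vn)|<\infty$. The number $$\alpha(v)=\inf_{n\ge1}\frac{\mathsf E A^{0,n}(0,vn)}{n}$$ is finite and satisfies $$\frac{A^{0,n}(0,vn)}{n}\to\alpha(v)\qquad\text{almost surely and in }L^1,\quad n\to\infty.$$ It does not depend on the choice of $p\in[0,1]$. Moreover, $$\alpha(v)=\alpha(0)+\frac{v^2}{2},\qquad v\in\mathbb R.$$ -/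

import Mathlib

open MeasureTheory ProbabilityTheory Filter Topology

noncomputable section

/-- The data of the shot-noise model: the shape `φ` of a kick and the laws of the amplitudes `ξ`
and of the scaling factors `κ`. -/
structure ShotNoise where
  /-- the deterministic profile of one kick -/
  φ : ℝ → ℝ
  differentiable_φ : Differentiable ℝ φ
  even_φ : ∀ x, φ (-x) = φ x
  /-- the law of the amplitude of a kick -/
  Pξ : Measure ℝ
  /-- the law of the spatial scaling factor of a kick -/
  Pκ : Measure ℝ
  prob_ξ : IsProbabilityMeasure Pξ
  prob_κ : IsProbabilityMeasure Pκ
  Rx : ℝ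
  Rξ : ℝ
  Rκ : ℝ
  Rx_pos : 0 < Rx
  Rξ_pos : 0 < Rξ
  Rκ_pos : 0 < Rκ
  support_nonempty : (Function.support φ).Nonempty
  support_subset : Function.support φ ⊆ Set.Ioo (-Rx) Rx
  ae_ξ : ∀ᵐ a ∂Pξ, a ∈ Set.Icc (-Rξ) Rξ
  ae_κ : ∀ᵐ s ∂Pκ, s ∈ Set.Ioc 0 Rκ

attribute [instance] ShotNoise.prob_ξ ShotNoise.prob_κ

/-- Points `(τ, η, ξ, κ)`: time, position, amplitude, scaling factor. -/
abbrev MarkedPoint : Type := ℤ × ℝ × ℝ × ℝ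

/-- Locally finite point configurations on `ℤ × ℝ × ℝ × ℝ`. -/
structure Config where
  points : Set MarkedPoint
  locallyFinite : ∀ B : Set MarkedPoint, Bornology.IsBounded B → (points ∩ B).Finite

/-- The number `ω(B)` of configuration points in `B` (used for bounded `B` only). -/
def Config.count (B : Set MarkedPoint) (ω : Config) : ℕ := (ω.points ∩ B).ncard

/-- The σ-algebra generated by the maps `ω ↦ ω(B)`, for bounded Borel sets `B`. -/
instance Config.instMeasurableSpace : MeasurableSpace Config :=
  ⨆ B : {B : Set MarkedPoint // Bornology.IsBounded B ∧ MeasurableSet B},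
    MeasurableSpace.comap (Config.count B.1) ⊤

/-- `P` is the law of the Poisson point process with driving measure `μ`. -/
structure IsPoissonLaw (μ : Measure MarkedPoint) (P : Measure Config) : Prop where
  isProbabilityMeasure : IsProbabilityMeasure P
  indep : ∀ (k : ℕ) (B : Fin k → Set MarkedPoint),
    (∀ i, Bornology.IsBounded (B i)) → (∀ i, MeasurableSet (B i)) →
    Pairwise (fun i j => Disjoint (B i) (B j)) →
    iIndepFun (fun i => Config.count (B i)) P
  map_count : ∀ B : Set MarkedPoint, Bornology.IsBounded B → MeasurableSet B →
    P.map (Config.count B) = poissonMeasure (μ B).toNNReal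

namespace ShotNoise

variable (M : ShotNoise)

/-- The driving measure: counting measure × Lebesgue measure × `Pξ` × `Pκ`. -/
def drivingMeasure : Measure MarkedPoint :=
  (Measure.count : Measure ℤ).prod ((volume : Measure ℝ).prod (M.Pξ.prod M.Pκ))

/-- The random potential `F_ω(n, x)`: the sum of `ξ φ((x - η) / κ)` over all points
`(n, η, ξ, κ)` of `ω`. -/
def potential (ω : Config) (n : ℤ) (x : ℝ) : ℝ :=
  ∑' q : {q : ℝ × ℝ × ℝ // (n, q) ∈ ω.points},
    q.1.2.1 * M.φ ((x - q.1.1) / q.1.2.2)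

/-- The action `S^{n₀,n₁}(γ) + F_ω^{n₀,n₁}(γ)` with endpoint weights `p` and `1 - p`. It only
depends on the values of `γ` on `{n₀, …, n₁}`, so paths are represented by functions on `ℤ`. -/
def action (p : ℝ) (ω : Config) (n₀ n₁ : ℤ) (γ : ℤ → ℝ) : ℝ :=
  (1 / 2) * ∑ k ∈ Finset.Ico n₀ n₁, (γ (k + 1) - γ k) ^ 2
    + (p * M.potential ω n₀ (γ n₀)
      + ∑ k ∈ Finset.Ioo n₀ n₁, M.potential ω k (γ k)
      + (1 - p) * M.potential ω n₁ (γ n₁))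

/-- The set of the actions of all paths from `(n₀, x)` to `(n₁, y)`. -/
def actionValues (p : ℝ) (ω : Config) (n₀ n₁ : ℤ) (x y : ℝ) : Set ℝ :=
  {a | ∃ γ : ℤ → ℝ, γ n₀ = x ∧ γ n₁ = y ∧ M.action p ω n₀ n₁ γ = a}

/-- The optimal action `A_ω^{n₀,n₁}(x, y)`. -/
def optimalAction (p : ℝ) (ω : Config) (n₀ n₁ : ℤ) (x y : ℝ) : ℝ :=
  sInf (M.actionValues p ω n₀ n₁ x y)

/-- The shape function `α(v)`: the infimum of `E A^{0,n}(0, vn) / n` over `n ≥ 1`. -/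
def shapeFunction (P : Measure Config) (p v : ℝ) : ℝ :=
  ⨅ n : ℕ+, (∫ ω, M.optimalAction p ω 0 (n : ℕ) 0 (v * (n : ℕ)) ∂P) / (n : ℕ)

end ShotNoise

end

/-! A Poisson process is independent over disjoint time slices and invariant under spatial
translation. Reading the slice at time k from position vk therefore turns the environment into an
i.i.d. sequence whose law does not depend on v. Subtracting the line vk from a path expands its
kinetic energy, and the cross term telescopes to zero since the new path runs from 0 to 0. Hence
A^{0,n}(0,vn) equals the least cost of a bridge from 0 to 0 in an i.i.d. environment, plus v²n/2,
plus p times the difference of two potentials at the fixed endpoints (`actionValues_eq_image`,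
`measurePreserving_sheared`). That last term has mean zero and is o(n) almost surely, so p
disappears from the limit. Everything reduces to a law of large numbers for the bridge cost, with
all of the endpoint weight at the final time.

Lower bounds come from discretising space. Rounding a path to unit cells bounds exp(-cost) by one
term of a partition function, at the price of only half of the kinetic energy
(`ofReal_exp_le_partition`). Exponential moments of the Poisson counts give an expected partition
function of at most exponential size. This yields attained minima, integrability, and a drift C for
which the lower tail of cost + Cn is summable (`exists_drift`).

The limit is proved by second moments. Let X_n be the positive part of cost + Cn. Concatenating
bridges and using independence of the two blocks gives E X_{2n}² ≤ 2 E X_n² + 2 (E X_n)². After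
division by (2n)² this makes the variances of X_n/n summable along n = m·2^k, and Fekete's lemma
identifies the limit of the means. To fill the gaps, compare with the path resting at 0: subtracting
the least cost from the sum of the local bounds g(y_k, 0) gives a monotone sequence, and the strong
law handles the sum. Scheffé's lemma applied to X_n/n ≥ 0 gives convergence in mean. -/

noncomputable section

/-! ### Independence of blocks; the measurable space of point configurations -/

/-- Blocks of an independent family of random variables are independent. -/
lemma ProbabilityTheory.iIndepFun.sigma_blocks {Ω ι : Type*} {mΩ : MeasurableSpace Ω}
    {P : Measure Ω} {κ : ι → Type*} {E : Type*} [MeasurableSpace E]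
    {X : (i : ι) → κ i → Ω → E} (mX : ∀ i j, Measurable (X i j))
    (h : iIndepFun (fun (p : (i : ι) × κ i) ω => X p.1 p.2 ω) P) :
    iIndepFun (fun i ω j => X i j ω) P := by
  have := h.isProbabilityMeasure
  have : ∀ i j, IsProbabilityMeasure (P.map (X i j)) :=
    fun i j => Measure.isProbabilityMeasure_map (mX i j).aemeasurable
  have h2 : ∀ i, iIndepFun (X i) P := fun i =>
    h.precomp (g := fun j : κ i => (⟨i, j⟩ : (i : ι) × κ i)) sigma_mk_injective
  have hc : (MeasurableEquiv.piCurry fun (i : ι) (_ : κ i) => E) ∘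
      (fun ω (p : (i : ι) × κ i) => X p.1 p.2 ω) = fun ω i j => X i j ω := by
    ext; simp [Sigma.curry]
  have hm : Measurable fun ω (p : (i : ι) × κ i) => X p.1 p.2 ω := by fun_prop
  rw [iIndepFun_iff_map_fun_eq_infinitePi_map (by fun_prop), ← hc,
    ← Measure.map_map (by fun_prop) hm,
    (iIndepFun_iff_map_fun_eq_infinitePi_map (by fun_prop)).1 h,
    Measure.infinitePi_map_piCurry (fun i j => P.map (X i j))]
  congr 1
  funext i
  rw [(iIndepFun_iff_map_fun_eq_infinitePi_map (by fun_prop)).1 (h2 i)]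

/-- Bounded Borel sets of marked points. -/
abbrev BoundedBorel : Type := {B : Set MarkedPoint // Bornology.IsBounded B ∧ MeasurableSet B}

namespace Config

lemma measurable_count {B : Set MarkedPoint} (hb : Bornology.IsBounded B) (hm : MeasurableSet B) :
    Measurable (count B) := by
  apply Measurable.of_comap_le
  exact le_iSup (fun B : BoundedBorel => MeasurableSpace.comap (count B.1) ⊤) ⟨B, hb, hm⟩

/-- Seen as a pullback from a product space, the σ-algebra lets questions on measurability, laws and
independence of configurations be settled on families of counts. -/
lemma measurableSpace_eq_comap :
    Config.instMeasurableSpace =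
      MeasurableSpace.comap (fun ω (B : BoundedBorel) => count B.1 ω) MeasurableSpace.pi := by
  simp only [Config.instMeasurableSpace, MeasurableSpace.pi, MeasurableSpace.comap_iSup,
    MeasurableSpace.comap_comp]
  rfl

lemma measurable_iff_count {α : Type*} [MeasurableSpace α] {f : α → Config}
    (h : ∀ B : Set MarkedPoint, Bornology.IsBounded B → MeasurableSet B →
      Measurable fun a => count B (f a)) : Measurable f := by
  rw [measurable_iff_comap_le, measurableSpace_eq_comap, MeasurableSpace.comap_comp,
    ← measurable_iff_comap_le]
  exact measurable_pi_lambda _ fun B => h B.1 B.2.1 B.2.2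

/-- The configuration of the points lying in `S`. -/
def restrict (S : Set MarkedPoint) (ω : Config) : Config where
  points := ω.points ∩ S
  locallyFinite B hB := (ω.locallyFinite B hB).subset (by gcongr; exact Set.inter_subset_left)

lemma count_restrict (S B : Set MarkedPoint) (ω : Config) :
    count B (restrict S ω) = count (B ∩ S) ω := by
  simp only [count, restrict]
  congr 1
  ext; simp; tauto

lemma measurable_restrict {S : Set MarkedPoint} (hS : MeasurableSet S) :
    Measurable (restrict S) := by
  refine measurable_iff_count fun B hb hm => ?_
  simp only [count_restrict]
  exact measurable_count (hb.subset Set.inter_subset_left) (hm.inter hS)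

lemma isBounded_preimage_add (u : MarkedPoint) {B : Set MarkedPoint}
    (hB : Bornology.IsBounded B) : Bornology.IsBounded ((u + ·) ⁻¹' B) := by
  have : (u + ·) ⁻¹' B = (-u + ·) '' B := by
    ext z; simp
  rw [this]
  exact (LipschitzWith.of_dist_le_mul (K := 1) (by simp)).isBounded_image hB

/-- The configuration shiftd by `-u`. -/
def shift (u : MarkedPoint) (ω : Config) : Config where
  points := (u + ·) ⁻¹' ω.points
  locallyFinite B hB := by
    have h := ω.locallyFinite _ (isBounded_preimage_add (-u) hB)
    have : (u + ·) ⁻¹' ω.points ∩ B = (u + ·) ⁻¹' (ω.points ∩ (-u + ·) ⁻¹' B) := by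
      ext; simp
    rw [this]
    exact h.preimage (add_right_injective u).injOn

lemma count_shift (u : MarkedPoint) (B : Set MarkedPoint) (ω : Config) :
    count B (shift u ω) = count ((-u + ·) ⁻¹' B) ω := by
  have : (u + ·) ⁻¹' ω.points ∩ B = (-u + ·) '' (ω.points ∩ (-u + ·) ⁻¹' B) := by
    ext z; simp
  simp only [count, shift, this]
  exact Set.ncard_image_of_injective _ (add_right_injective _)

lemma measurable_shift (u : MarkedPoint) : Measurable (shift u) := by
  refine measurable_iff_count fun B hb hm => ?_
  simp only [count_shift]
  exact measurable_count (isBounded_preimage_add _ hb) (measurable_const_add _ hm)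

/-- The atom, in the partition generated by the family `B`, of the points that lie in `B i`
exactly for the indices `i ∈ s`. -/
def atom {I : Type*} (B : I → Set MarkedPoint) (s : Finset I) : Set MarkedPoint :=
  (⋃ i, B i) ∩ {z | ∀ i, z ∈ B i ↔ i ∈ s}

section atoms

variable {I : Type*} {B : I → Set MarkedPoint}

lemma isBounded_atom [Finite I] (hb : ∀ i, Bornology.IsBounded (B i)) (s : Finset I) :
    Bornology.IsBounded (atom B s) :=
  ((Bornology.isBounded_iUnion).2 hb).subset Set.inter_subset_left

lemma measurableSet_atom [Fintype I] (hm : ∀ i, MeasurableSet (B i)) (s : Finset I) :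
    MeasurableSet (atom B s) := by
  refine (MeasurableSet.iUnion hm).inter ?_
  rw [Set.ofPred_forall]
  refine MeasurableSet.iInter fun i => ?_
  by_cases h : i ∈ s
  · simpa [h] using hm i
  · have : {z | z ∈ B i ↔ i ∈ s} = (B i)ᶜ := by ext; simp [h]
    rw [this]
    exact (hm i).compl

lemma disjoint_atom {s t : Finset I} (h : s ≠ t) : Disjoint (atom B s) (atom B t) := by
  rw [Set.disjoint_left]
  rintro z ⟨-, hs⟩ ⟨-, ht⟩
  exact h (Finset.ext fun i => (hs i).symm.trans (ht i))

lemma count_eq_sum_atom [Fintype I] [DecidableEq I]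
    (hb : ∀ i, Bornology.IsBounded (B i)) (i : I) (ω : Config) :
    count (B i) ω = ∑ s with i ∈ s, count (atom B s) ω := by
  classical
  have hfin := ω.locallyFinite _ (hb i)
  have hf (s : Finset I) := ω.locallyFinite _ (isBounded_atom hb s)
  rw [count, Set.ncard_eq_toFinset_card _ hfin, Finset.card_eq_sum_card_fiberwise
    (f := fun z => Finset.univ.filter fun j => z ∈ B j) (t := Finset.univ.filter fun s => i ∈ s)]
  · refine Finset.sum_congr rfl fun s hs => ?_
    rw [count, Set.ncard_eq_toFinset_card _ (hf s)]
    congr 1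
    ext z
    simp only [Finset.mem_filter, Finset.mem_univ, true_and] at hs
    simp only [Finset.mem_filter, Set.Finite.mem_toFinset, Set.mem_inter_iff, atom, Set.mem_iUnion,
      Set.mem_ofPred_eq, Finset.ext_iff, Finset.mem_univ, true_and]
    constructor
    · rintro ⟨⟨h1, h2⟩, h3⟩
      exact ⟨h1, ⟨i, h2⟩, h3⟩
    · rintro ⟨h1, -, h3⟩
      exact ⟨⟨h1, (h3 i).2 hs⟩, h3⟩
  · intro z hz
    simp at hz ⊢
    exact hz.2

end atoms

/-- The points in `B` form a random measure `Γ` whose values are counts, hence `Γ` is measurable,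
and so is the integral against it of a nonnegative function. A real `g` is split into positive and
negative parts. -/
lemma measurable_sum {B : Set MarkedPoint} (hb : Bornology.IsBounded B) (hB : MeasurableSet B)
    {g : MarkedPoint → ℝ} (hg : Measurable g) :
    Measurable fun ω : Config => ∑ z ∈ (ω.locallyFinite B hb).toFinset, g z := by
  let Γ : Config → Measure MarkedPoint := fun ω =>
    ∑ z ∈ (ω.locallyFinite B hb).toFinset, Measure.dirac z
  have hΓ : Measurable Γ := by
    refine Measure.measurable_of_measurable_coe _ fun S hS => ?_
    have : (fun ω => Γ ω S) = fun ω => (count (B ∩ S) ω : ENNReal) := by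
      classical
      funext ω
      simp only [Γ, Measure.coe_finsetSum, Finset.sum_apply, Measure.dirac_apply' _ hS,
        Set.indicator_apply, Pi.one_apply, Finset.sum_boole]
      rw [count, Set.ncard_eq_toFinset_card _ (ω.locallyFinite _ (hb.subset Set.inter_subset_left))]
      congr 2
      ext; simp [and_assoc]
    rw [this]
    exact (measurable_of_countable _).comp
      (measurable_count (hb.subset Set.inter_subset_left) (hB.inter hS))
  have key (h : MarkedPoint → ENNReal) (hh : Measurable h) :
      Measurable fun ω : Config => ∑ z ∈ (ω.locallyFinite B hb).toFinset, h z := by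
    have h1 := (Measure.measurable_lintegral hh).comp hΓ
    convert h1 using 1
    funext ω
    simp [Γ, lintegral_finsetSum_measure, lintegral_dirac' _ hh]
  have h1 := (key (fun z => ENNReal.ofReal (g z)) (by fun_prop)).ennreal_toReal
  have h2 := (key (fun z => ENNReal.ofReal (-g z)) (by fun_prop)).ennreal_toReal
  convert h1.sub h2 using 1
  funext ω
  simp only [Pi.sub_apply]
  rw [ENNReal.toReal_sum (by simp), ENNReal.toReal_sum (by simp), ← Finset.sum_sub_distrib]
  refine Finset.sum_congr rfl fun z _ => ?_
  rw [ENNReal.toReal_ofReal', ENNReal.toReal_ofReal']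
  rcases le_total 0 (g z) with h | h
  · simp [h]
  · simp [h]

end Config

/-! ### Uniqueness, translation invariance and independence of Poisson laws -/

namespace IsPoissonLaw

open Config

variable {μ : Measure MarkedPoint} {P P' : Measure Config}

lemma iIndepFun_count (hP : IsPoissonLaw μ P) {J : Type*} [Fintype J] {A : J → Set MarkedPoint}
    (hb : ∀ j, Bornology.IsBounded (A j)) (hm : ∀ j, MeasurableSet (A j))
    (hd : Pairwise fun i j => Disjoint (A i) (A j)) : iIndepFun (fun j => count (A j)) P := by
  let e := Fintype.equivFin J
  have h := hP.indep _ (fun i => A (e.symm i)) (fun i => hb _) (fun i => hm _)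
    (fun i j hij => hd (e.symm.injective.ne hij))
  have h' := h.precomp e.injective
  simpa using h'

/-- Each `B i` is a disjoint union of atoms, whose counts are independent Poisson variables with
parameters fixed by `μ`. Both joint laws are thus the image of one product measure under the same
summation map. -/
lemma map_count_family (hP : IsPoissonLaw μ P) (hP' : IsPoissonLaw μ P') {I : Type*} [Fintype I]
    {B : I → Set MarkedPoint} (hb : ∀ i, Bornology.IsBounded (B i))
    (hm : ∀ i, MeasurableSet (B i)) :
    P.map (fun ω i => count (B i) ω) = P'.map (fun ω i => count (B i) ω) := by
  classical
  have hA (s : Finset I) : Measurable (count (atom B s)) :=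
    measurable_count (isBounded_atom hb s) (measurableSet_atom hm s)
  have key {R : Measure Config} (hR : IsPoissonLaw μ R) :
      R.map (fun ω i => count (B i) ω) =
        (Measure.pi fun s => poissonMeasure (μ (atom B s)).toNNReal).map
          (fun a i => ∑ s with i ∈ s, a s) := by
    have h1 := (hR.iIndepFun_count (isBounded_atom hb) (measurableSet_atom hm)
      (fun s t h => disjoint_atom h)).map_fun_eq_pi_map (fun s => (hA s).aemeasurable)
    simp only [hR.map_count _ (isBounded_atom hb _) (measurableSet_atom hm _)] at h1
    rw [← h1, Measure.map_map (by fun_prop) (by fun_prop)]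
    congr 1
    funext ω i
    exact count_eq_sum_atom hb i ω
  rw [key hP, key hP']

/-- The law of a Poisson point process is determined by its driving measure. -/
lemma unique (hP : IsPoissonLaw μ P) (hP' : IsPoissonLaw μ P') : P = P' := by
  let c : Config → BoundedBorel → ℕ := fun ω B => count B.1 ω
  have hc : Measurable c := measurable_pi_lambda _ fun B => measurable_count B.2.1 B.2.2
  have := hP.isProbabilityMeasure
  have := hP'.isProbabilityMeasure
  have hmap : P.map c = P'.map c := by
    refine IsProjectiveLimit.unique (P := fun I : Finset BoundedBorel => (P.map c).map I.restrict)
      (fun I => rfl) (fun I => ?_)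
    change (P'.map c).map I.restrict = (P.map c).map I.restrict
    rw [Measure.map_map (by fun_prop) hc, Measure.map_map (by fun_prop) hc]
    exact (hP.map_count_family hP' (B := fun i : I => i.1.1) (fun i => i.1.2.1)
      (fun i => i.1.2.2)).symm
  ext S hS
  rw [measurableSpace_eq_comap] at hS
  obtain ⟨T, hT, rfl⟩ := hS
  rw [← Measure.map_apply hc hT, hmap, Measure.map_apply hc hT]

/-- The shifted process is again Poisson with driving measure `μ`, so uniqueness of the law applies.
-/
lemma map_shift (hP : IsPoissonLaw μ P) (u : MarkedPoint)
    (hμ : ∀ B, MeasurableSet B → μ ((-u + ·) ⁻¹' B) = μ B) : P.map (shift u) = P := by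
  have := hP.isProbabilityMeasure
  refine unique (μ := μ) ⟨Measure.isProbabilityMeasure_map (measurable_shift u).aemeasurable,
    fun k B hb hm hd => ?_, fun B hb hm => ?_⟩ hP
  · have hb' i := isBounded_preimage_add (-u) (hb i)
    have hm' i : MeasurableSet ((-u + ·) ⁻¹' B i) := measurable_const_add _ (hm i)
    have h := hP.indep k (fun i => (-u + ·) ⁻¹' B i) hb' hm' (fun i j hij => (hd hij).preimage _)
    have e i : count ((-u + ·) ⁻¹' B i) = count (B i) ∘ shift u := by
      funext ω; exact (count_shift u (B i) ω).symm
    have hmc i := measurable_count (hb i) (hm i)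
    have : IsProbabilityMeasure (P.map (shift u)) :=
      Measure.isProbabilityMeasure_map (measurable_shift u).aemeasurable
    rw [iIndepFun_iff_map_fun_eq_pi_map (fun i => (measurable_count (hb' i) (hm' i)).aemeasurable)]
      at h
    rw [iIndepFun_iff_map_fun_eq_pi_map (fun i => (hmc i).aemeasurable),
      Measure.map_map (measurable_pi_lambda _ hmc) (measurable_shift u)]
    simp only [e] at h
    simp only [Measure.map_map (hmc _) (measurable_shift u)]
    exact h
  · rw [Measure.map_map (measurable_count hb hm) (measurable_shift u)]
    have e : count B ∘ shift u = count ((-u + ·) ⁻¹' B) := by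
      funext ω; exact count_shift u B ω
    rw [e, hP.map_count _ (isBounded_preimage_add _ hb) (measurable_const_add _ hm), hμ B hm]

/-- The restrictions of a Poisson process to disjoint sets are independent. -/
lemma iIndepFun_restrict (hP : IsPoissonLaw μ P) {κ : Type*} {S : κ → Set MarkedPoint}
    (hm : ∀ k, MeasurableSet (S k)) (hd : Pairwise fun i j => Disjoint (S i) (S j)) :
    iIndepFun (fun k => restrict (S k)) P := by
  have hX (k : κ) (B : BoundedBorel) : Measurable (count (B.1 ∩ S k)) :=
    measurable_count (B.2.1.subset Set.inter_subset_left) (B.2.2.inter (hm k))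
  have h := iIndepFun.iIndepFun_process (P := P) (T := fun _ : κ => BoundedBorel)
    (𝓧 := fun _ _ => ℕ) (X := fun k B => count (B.1 ∩ S k)) hX ?_
  · rw [iIndepFun_iff_iIndep] at h ⊢
    convert h using 2 with k
    rw [measurableSpace_eq_comap, MeasurableSpace.comap_comp]
    congr 1
    funext ω B
    exact count_restrict _ _ _
  · intro I J
    classical
    let A (k : I) (s : Finset (J k)) : Set MarkedPoint :=
      atom (fun B : J k => B.1.1 ∩ S k) s
    have hb (k : I) (B : J k) : Bornology.IsBounded (B.1.1 ∩ S k) :=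
      B.1.2.1.subset Set.inter_subset_left
    have hbm (k : I) (B : J k) : MeasurableSet (B.1.1 ∩ S k) := B.1.2.2.inter (hm k)
    have hAb k s : Bornology.IsBounded (A k s) := isBounded_atom (hb k) s
    have hAm k s : MeasurableSet (A k s) := measurableSet_atom (hbm k) s
    have hAS k s : A k s ⊆ S k := by
      rintro z ⟨hz, -⟩
      obtain ⟨B, hB⟩ := Set.mem_iUnion.1 hz
      exact hB.2
    -- Atoms of one block are disjoint by construction and those of different blocks lie in disjoint
    -- sets `S k`. All of them together are one disjoint family, whose independence is then grouped
    -- by block.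
    have h1 : iIndepFun (fun (p : (k : I) × Finset (J k)) ω => count (A p.1 p.2) ω) P := by
      refine hP.iIndepFun_count (fun p => hAb _ _) (fun p => hAm _ _) ?_
      rintro ⟨k, s⟩ ⟨l, t⟩ hne
      by_cases hkl : k = l
      · subst hkl
        exact disjoint_atom fun hst => hne (congrArg (Sigma.mk k) hst)
      · exact (hd fun h => hkl (Subtype.ext h)).mono (hAS k s) (hAS l t)
    have h2 := h1.sigma_blocks (X := fun k s ω => count (A k s) ω)
      (fun k s => measurable_count (hAb k s) (hAm k s))
    have h3 := h2.comp (fun k (a : Finset (J k) → ℕ) (B : J k) => ∑ s with B ∈ s, a s)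
      (fun k => by fun_prop)
    convert h3 using 2 with k
    funext ω B
    exact count_eq_sum_atom (hb k) B ω

/-- Counts are controlled only on bounded sets, so `S` is exhausted by balls; on each the count is
Poisson with parameter 0. -/
lemma ae_disjoint (hP : IsPoissonLaw μ P) {S : Set MarkedPoint} (hm : MeasurableSet S)
    (hS : μ S = 0) : ∀ᵐ ω ∂P, Disjoint ω.points S := by
  have h (n : ℕ) : ∀ᵐ ω ∂P, count (S ∩ Metric.closedBall 0 n) ω = 0 := by
    have hb : Bornology.IsBounded (S ∩ Metric.closedBall 0 (n : ℝ)) :=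
      Metric.isBounded_closedBall.subset Set.inter_subset_right
    have hm' : MeasurableSet (S ∩ Metric.closedBall 0 (n : ℝ)) :=
      hm.inter Metric.isClosed_closedBall.measurableSet
    have hmap := hP.map_count _ hb hm'
    rw [measure_mono_null Set.inter_subset_left hS] at hmap
    have h1 : ∀ᵐ k ∂(P.map (count (S ∩ Metric.closedBall 0 (n : ℝ)))), k = 0 := by
      rw [hmap, ae_iff]
      rw [← Set.compl_ofPred, prob_compl_eq_zero_iff (by measurability)]
      simp [poissonMeasure_singleton]
    exact ae_of_ae_map (measurable_count hb hm').aemeasurable h1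
  filter_upwards [ae_all_iff.2 h] with ω hω
  rw [Set.disjoint_left]
  intro z hz hzS
  obtain ⟨n, hn⟩ := exists_nat_ge (dist z 0)
  have h0 := hω n
  have hb : Bornology.IsBounded (S ∩ Metric.closedBall 0 (n : ℝ)) :=
    Metric.isBounded_closedBall.subset Set.inter_subset_right
  rw [count, Set.ncard_eq_zero (ω.locallyFinite _ hb)] at h0
  exact (h0 ▸ ⟨hz, hzS, hn⟩ : z ∈ (∅ : Set MarkedPoint))

end IsPoissonLaw

lemma ProbabilityTheory.lintegral_exp_poissonMeasure_lt_top (r : NNReal) (c : ℝ) :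
    ∫⁻ k : ℕ, ENNReal.ofReal (Real.exp (c * k)) ∂(poissonMeasure r) < ⊤ := by
  refine Integrable.lintegral_lt_top ?_
  rw [integrable_poissonMeasure_iff]
  have h := (Real.summable_pow_div_factorial (r * Real.exp c)).mul_left (Real.exp (-r))
  refine h.congr fun n => ?_
  rw [Real.norm_eq_abs, abs_of_pos (Real.exp_pos _), mul_comm c, Real.exp_nat_mul, mul_pow]
  ring

/-! ### The shot-noise field of one time slice -/

namespace ShotNoise

open Config

variable (M : ShotNoise)

lemma exists_bound_φ : ∃ C : ℝ, 0 ≤ C ∧ ∀ x, |M.φ x| ≤ C := by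
  have hs : HasCompactSupport M.φ := HasCompactSupport.intro (K := Set.Icc (-M.Rx) M.Rx)
    isCompact_Icc fun x hx => by
      by_contra h
      exact hx (Set.Ioo_subset_Icc_self (M.support_subset h))
  obtain ⟨C, hC⟩ := M.differentiable_φ.continuous.bounded_above_of_compact_support hs
  exact ⟨C, (norm_nonneg _).trans (hC 0), hC⟩

/-- The marked points whose marks lie in the essential ranges of the mark distributions. -/
def admissible : Set MarkedPoint :=
  {z | z.2.2.1 ∈ Set.Icc (-M.Rξ) M.Rξ ∧ z.2.2.2 ∈ Set.Ioc 0 M.Rκ}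

/-- Admissible marked points at time `0` with position in `[a, b]`. -/
def window (a b : ℝ) : Set MarkedPoint :=
  {0} ×ˢ Set.Icc a b ×ˢ Set.Icc (-M.Rξ) M.Rξ ×ˢ Set.Ioc 0 M.Rκ

/-- The contribution of a marked point to the potential at `x`. -/
def kick (x : ℝ) (z : MarkedPoint) : ℝ := z.2.2.1 * M.φ ((x - z.2.1) / z.2.2.2)

/-- The range of a kick. -/
def range : ℝ := M.Rx * M.Rκ

lemma measurableSet_admissible : MeasurableSet M.admissible := by
  refine MeasurableSet.inter (s₁ := {z : MarkedPoint | z.2.2.1 ∈ Set.Icc (-M.Rξ) M.Rξ})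
    (s₂ := {z : MarkedPoint | z.2.2.2 ∈ Set.Ioc 0 M.Rκ}) ?_ ?_
  · exact (by fun_prop : Measurable fun z : MarkedPoint => z.2.2.1) measurableSet_Icc
  · exact (by fun_prop : Measurable fun z : MarkedPoint => z.2.2.2) measurableSet_Ioc

lemma isBounded_window (a b : ℝ) : Bornology.IsBounded (M.window a b) :=
  Bornology.isBounded_singleton.prod ((Metric.isBounded_Icc _ _).prod
    ((Metric.isBounded_Icc _ _).prod (Metric.isBounded_Ioc _ _)))

lemma measurableSet_window (a b : ℝ) : MeasurableSet (M.window a b) :=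
  (measurableSet_singleton _).prod (measurableSet_Icc.prod
    (measurableSet_Icc.prod measurableSet_Ioc))

lemma measurable_kick (x : ℝ) : Measurable (M.kick x) := by
  have := M.differentiable_φ.continuous.measurable
  unfold kick
  fun_prop

lemma kick_eq_zero {x : ℝ} {z : MarkedPoint} (hz : z ∈ M.admissible)
    (h : z.2.1 ∉ Set.Icc (x - M.range) (x + M.range)) : M.kick x z = 0 := by
  have : M.φ ((x - z.2.1) / z.2.2.2) = 0 := by
    by_contra h0
    obtain ⟨h1, h2⟩ := M.support_subset h0
    have hκ := hz.2.1
    rw [lt_div_iff₀ hκ] at h1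
    rw [div_lt_iff₀ hκ] at h2
    have : M.Rx * z.2.2.2 ≤ M.range := by
      unfold range; exact mul_le_mul_of_nonneg_left hz.2.2 M.Rx_pos.le
    exact h ⟨by linarith, by linarith⟩
  rw [kick, this, mul_zero]

/-- The potential at time `0` generated by the admissible points. -/
def field (ω : Config) (x : ℝ) : ℝ := M.potential (restrict M.admissible ω) 0 x

/-- Admissible kicks have bounded range, so the `tsum` is a finite sum for every `ω`, not just
almost surely. The window may be taken larger than necessary, so one finite sum serves all `x` in an
interval; continuity and cell bounds rest on this. -/
lemma field_eq_sum (ω : Config) {x a b : ℝ} (ha : a ≤ x - M.range) (hb : x + M.range ≤ b) :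
    M.field ω x =
      ∑ z ∈ (ω.locallyFinite _ (M.isBounded_window a b)).toFinset, M.kick x z := by
  classical
  have hfin := (ω.locallyFinite _ (M.isBounded_window a b))
  refine (tsum_subtype {q : ℝ × ℝ × ℝ | ((0 : ℤ), q) ∈
    (restrict M.admissible ω).points} (fun q => M.kick x (0, q))).trans ?_
  rw [tsum_eq_sum (s := hfin.toFinset.image Prod.snd)]
  · rw [Finset.sum_image]
    · refine Finset.sum_congr rfl fun z hz => ?_
      obtain ⟨n, q⟩ := z
      rw [Set.Finite.mem_toFinset] at hz
      obtain ⟨h1, h2, h3, h4⟩ := hz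
      obtain rfl : n = 0 := h2
      rw [Set.indicator_of_mem]
      exact ⟨h1, h4⟩
    · rintro ⟨n, q⟩ hz ⟨n', q'⟩ hz' h
      simp only [Finset.mem_coe, Set.Finite.mem_toFinset] at hz hz'
      obtain rfl : n = 0 := hz.2.1
      obtain rfl : n' = 0 := hz'.2.1
      exact Prod.ext rfl h
  · intro q hq
    rw [Set.indicator_apply_eq_zero]
    rintro ⟨h1, h2⟩
    refine M.kick_eq_zero h2 fun h3 => hq ?_
    rw [Finset.mem_image]
    refine ⟨(0, q), ?_, rfl⟩
    rw [Set.Finite.mem_toFinset]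
    exact ⟨h1, rfl, ⟨ha.trans h3.1, h3.2.trans hb⟩, h2⟩

lemma measurable_field (x : ℝ) : Measurable fun ω => M.field ω x := by
  simp_rw [fun ω => M.field_eq_sum ω (le_refl (x - M.range)) (le_refl (x + M.range))]
  exact measurable_sum (M.isBounded_window _ _) (M.measurableSet_window _ _) (M.measurable_kick x)

lemma continuous_field (ω : Config) : Continuous (M.field ω) := by
  rw [continuous_iff_continuousAt]
  intro x
  have h : (fun y => ∑ z ∈ (ω.locallyFinite _ (M.isBounded_window (x - 1 - M.range)
      (x + 1 + M.range))).toFinset, M.kick y z) =ᶠ[𝓝 x] M.field ω := by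
    filter_upwards [Icc_mem_nhds (by linarith : x - 1 < x) (by linarith : x < x + 1)] with y hy
    rw [M.field_eq_sum ω (a := x - 1 - M.range) (b := x + 1 + M.range) (by linarith [hy.1])
      (by linarith [hy.2])]
  refine ContinuousAt.congr ?_ h
  have := M.differentiable_φ.continuous
  refine Continuous.continuousAt ?_
  unfold kick
  fun_prop

/-- The points that may contribute to the potential somewhere in `[i, i + 1]`. -/
def cell (i : ℤ) : Set MarkedPoint := M.window (i - M.range) (i + 1 + M.range)

lemma measurable_count_cell (i : ℤ) : Measurable (count (M.cell i)) :=
  measurable_count (M.isBounded_window _ _) (M.measurableSet_window _ _)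

lemma exists_abs_field_le :
    ∃ c : ℝ, 0 ≤ c ∧ ∀ ω x, |M.field ω x| ≤ c * count (M.cell ⌊x⌋) ω := by
  obtain ⟨C, hC0, hC⟩ := M.exists_bound_φ
  refine ⟨M.Rξ * C, mul_nonneg M.Rξ_pos.le hC0, fun ω x => ?_⟩
  have hfin := ω.locallyFinite _ (M.isBounded_window (⌊x⌋ - M.range) (⌊x⌋ + 1 + M.range))
  rw [M.field_eq_sum ω (a := ⌊x⌋ - M.range) (b := ⌊x⌋ + 1 + M.range)
    (by linarith [Int.floor_le x]) (by linarith [Int.lt_floor_add_one x])]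
  refine (Finset.abs_sum_le_sum_abs _ _).trans ?_
  refine (Finset.sum_le_card_nsmul _ _ (M.Rξ * C) fun z hz => ?_).trans_eq ?_
  · rw [Set.Finite.mem_toFinset] at hz
    rw [kick, abs_mul]
    exact mul_le_mul (abs_le.2 hz.2.2.2.1) (hC _) (abs_nonneg _) M.Rξ_pos.le
  · rw [count, cell, Set.ncard_eq_toFinset_card _ hfin, nsmul_eq_mul, mul_comm]

lemma drivingMeasure_cell (i : ℤ) : M.drivingMeasure (M.cell i) = M.drivingMeasure (M.cell 0) := by
  simp only [drivingMeasure, cell, window, Measure.prod_prod, Real.volume_Icc]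
  congr 3
  push_cast
  ring

lemma drivingMeasure_preimage_add (k : ℤ) (a : ℝ) {B : Set MarkedPoint} (hB : MeasurableSet B) :
    M.drivingMeasure (((k, a, 0, 0) + · : MarkedPoint → MarkedPoint) ⁻¹' B) =
      M.drivingMeasure B := by
  have h1 : MeasurePreserving (k + ·) (Measure.count : Measure ℤ) Measure.count :=
    measurePreserving_add_left _ k
  have h2 : MeasurePreserving (a + ·) (volume : Measure ℝ) volume :=
    measurePreserving_add_left _ a
  have h := h1.prod (h2.prod (MeasurePreserving.id (M.Pξ.prod M.Pκ)))
  have e : ((k, a, 0, 0) + · : MarkedPoint → MarkedPoint) =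
      Prod.map (k + ·) (Prod.map (a + ·) id) := by
    funext z; simp [Prod.ext_iff]
  rw [e]
  exact h.measure_preimage hB.nullMeasurableSet

lemma drivingMeasure_compl_admissible : M.drivingMeasure M.admissibleᶜ = 0 := by
  have h : ∀ᵐ q ∂(M.Pξ.prod M.Pκ), q.1 ∈ Set.Icc (-M.Rξ) M.Rξ ∧ q.2 ∈ Set.Ioc 0 M.Rκ :=
    (Measure.quasiMeasurePreserving_fst.ae M.ae_ξ).and
      (Measure.quasiMeasurePreserving_snd.ae M.ae_κ)
  have h1 : ∀ᵐ q ∂((volume : Measure ℝ).prod (M.Pξ.prod M.Pκ)),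
      q.2.1 ∈ Set.Icc (-M.Rξ) M.Rξ ∧ q.2.2 ∈ Set.Ioc 0 M.Rκ :=
    Measure.quasiMeasurePreserving_snd.ae h
  have h2 : ∀ᵐ z ∂M.drivingMeasure, z ∈ M.admissible :=
    Measure.quasiMeasurePreserving_snd.ae h1
  exact h2

/-- The marked points at time `k`. -/
def timeSlice (k : ℤ) : Set MarkedPoint := {z | z.1 = k}

lemma measurableSet_timeSlice (k : ℤ) : MeasurableSet (timeSlice k) :=
  measurable_fst (measurableSet_singleton k)

/-- The points of `ω` at time `k`, as a configuration at time `0` seen from position `a`. -/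
def env (k : ℤ) (a : ℝ) (ω : Config) : Config := shift (k, a, 0, 0) (restrict (timeSlice k) ω)

lemma measurable_env (k : ℤ) (a : ℝ) : Measurable (env k a) :=
  (measurable_shift _).comp (measurable_restrict (measurableSet_timeSlice k))

/-- Translation by `(k, a)` matches the points of the slice with those of `env k a ω`. The
hypothesis on `ω`, which holds almost surely, makes the restriction to admissible points harmless.
-/
lemma potential_eq_field {ω : Config} (hω : Disjoint ω.points M.admissibleᶜ) (k : ℤ) (a x : ℝ) :
    M.potential ω k (x + a) = M.field (env k a ω) x := by
  have hω' : ω.points ⊆ M.admissible := Set.disjoint_compl_right_iff_subset.1 hω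
  let e : {q : ℝ × ℝ × ℝ // (k, q) ∈ ω.points} ≃
      {q : ℝ × ℝ × ℝ // (0, q) ∈ (restrict M.admissible (env k a ω)).points} :=
    { toFun q := ⟨(q.1.1 - a, q.1.2), by
        have h : ((k, a, 0, 0) + (0, q.1.1 - a, q.1.2) : MarkedPoint) = (k, q.1) := by
          simp [Prod.ext_iff]
        refine ⟨?_, (hω' q.2 :)⟩
        refine Set.mem_preimage.2 ?_
        rw [h]
        exact ⟨q.2, rfl⟩⟩
      invFun q := ⟨(a + q.1.1, q.1.2), by
        have h : ((k, a, 0, 0) + (0, q.1) : MarkedPoint) = (k, a + q.1.1, q.1.2) := by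
          simp [Prod.ext_iff]
        rw [← h]
        exact q.2.1.1⟩
      left_inv q := by simp
      right_inv q := by simp }
  rw [field, potential, potential, ← e.tsum_eq]
  refine tsum_congr fun q => ?_
  simp only [e, Equiv.coe_fn_mk]
  congr 3
  ring

variable {M} {P : Measure Config}

/-- An environment is the zero slice of a shifted process, and the shift preserves the law.
Independence of the result from `a` is what makes the sheared model independent of the slope. -/
lemma map_env (hP : IsPoissonLaw M.drivingMeasure P) (k : ℤ) (a : ℝ) :
    P.map (env k a) = P.map (restrict (timeSlice 0)) := by
  have h : env k a = restrict (timeSlice 0) ∘ shift (k, a, 0, 0) := by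
    funext ω
    simp only [env, Function.comp, Config.shift, restrict, Config.mk.injEq]
    ext z
    simp [timeSlice]
  rw [h, ← Measure.map_map (measurable_restrict (measurableSet_timeSlice 0)) (measurable_shift _),
    hP.map_shift]
  intro B hB
  have := M.drivingMeasure_preimage_add (-k) (-a) hB
  simpa using this

lemma iIndepFun_env (hP : IsPoissonLaw M.drivingMeasure P) {κ : Type*} {t : κ → ℤ}
    (ht : Function.Injective t) (a : κ → ℝ) : iIndepFun (fun j => env (t j) (a j)) P := by
  have h := hP.iIndepFun_restrict (fun j => measurableSet_timeSlice (t j)) (fun i j hij => by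
    refine Set.disjoint_left.2 fun z hz hz' => ?_
    exact hij (ht ((hz : z.1 = _).symm.trans hz')))
  exact h.comp _ (fun j => measurable_shift (t j, a j, 0, 0))

/-- All cells are translates of each other, so their counts share one Poisson law, which has all
exponential moments. -/
lemma exists_lintegral_exp_count_cell_le (hP : IsPoissonLaw M.drivingMeasure P) (c : ℝ) :
    ∃ K : ENNReal, K ≠ ⊤ ∧ ∀ i, ∫⁻ e, ENNReal.ofReal (Real.exp (c * count (M.cell i) e))
      ∂(P.map (restrict (timeSlice 0))) ≤ K := by
  refine ⟨_, (lintegral_exp_poissonMeasure_lt_top (M.drivingMeasure (M.cell 0)).toNNReal c).ne,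
    fun i => le_of_eq ?_⟩
  have hmeas : Measurable fun e => ENNReal.ofReal (Real.exp (c * count (M.cell i) e)) :=
    (measurable_of_countable fun n : ℕ => ENNReal.ofReal (Real.exp (c * n))).comp
      (M.measurable_count_cell i)
  rw [← M.drivingMeasure_cell i,
    ← hP.map_count (M.cell i) (M.isBounded_window _ _) (M.measurableSet_window _ _),
    lintegral_map (by fun_prop) (M.measurable_count_cell i),
    lintegral_map hmeas (measurable_restrict (measurableSet_timeSlice 0))]
  refine lintegral_congr fun ω => ?_
  rw [count_restrict]
  congr 5
  rw [Set.inter_eq_left]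
  exact fun z hz => hz.1

end ShotNoise

/-! ### Least bridge costs in a fixed environment -/

/-- An infimum over a dense set of parameters equals the infimum over all parameters. -/
lemma Real.sInf_range_comp_denseRange {X ι : Type*} [TopologicalSpace X] [Nonempty ι]
    {h : X → ℝ} (hh : Continuous h) {s : ι → X} (hs : DenseRange s) :
    sInf (Set.range (h ∘ s)) = sInf (Set.range h) := by
  have hlb : lowerBounds (Set.range (h ∘ s)) = lowerBounds (Set.range h) := by
    ext a
    constructor
    · rintro ha _ ⟨x, rfl⟩
      exact hs.induction_on x (isClosed_le continuous_const hh) fun i => ha ⟨i, rfl⟩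
    · rintro ha _ ⟨i, rfl⟩
      exact ha ⟨s i, rfl⟩
  have hX : Nonempty X := Nonempty.map s inferInstance
  by_cases hb : BddBelow (Set.range h)
  · have hb' : BddBelow (Set.range (h ∘ s)) := by
      rw [BddBelow, hlb]; exact hb
    have h1 := isGLB_csInf (Set.range_nonempty h) hb
    have h2 := isGLB_csInf (Set.range_nonempty (h ∘ s)) hb'
    rw [IsGLB, hlb] at h2
    exact h2.unique h1
  · have hb' : ¬ BddBelow (Set.range (h ∘ s)) := by
      rw [BddBelow, hlb]; exact hb
    rw [Real.sInf_of_not_bddBelow hb, Real.sInf_of_not_bddBelow hb']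

namespace Bridge

variable {E : Type*}

/-- The kinetic energy of the first `n` steps of a path. -/
def kinetic (n : ℕ) (γ : ℕ → ℝ) : ℝ := ∑ k ∈ Finset.range n, (γ (k + 1) - γ k) ^ 2

/-- The cost of the first `n` steps of a path in the environment `y`. -/
def cost (f : E → ℝ → ℝ) (n : ℕ) (y : ℕ → E) (γ : ℕ → ℝ) : ℝ :=
  1 / 2 * kinetic n γ + ∑ k ∈ Finset.range n, f (y k) (γ (k + 1))

/-- The costs of all bridges of length `n` from `0` to `0`. -/
def costValues (f : E → ℝ → ℝ) (n : ℕ) (y : ℕ → E) : Set ℝ :=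
  {c | ∃ γ : ℕ → ℝ, γ 0 = 0 ∧ γ n = 0 ∧ cost f n y γ = c}

/-- The least cost of a bridge of length `n` from `0` to `0`. -/
def minCost (f : E → ℝ → ℝ) (n : ℕ) (y : ℕ → E) : ℝ := sInf (costValues f n y)

/-- The environment seen from time `m` on. -/
def later (m : ℕ) (y : ℕ → E) : ℕ → E := fun k => y (m + k)

variable {f : E → ℝ → ℝ} {n m : ℕ} {y y' : ℕ → E} {γ γ' : ℕ → ℝ}

lemma kinetic_congr (h : ∀ k ≤ n, γ k = γ' k) : kinetic n γ = kinetic n γ' := by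
  refine Finset.sum_congr rfl fun k hk => ?_
  rw [Finset.mem_range] at hk
  rw [h k hk.le, h (k + 1) hk]

lemma cost_congr (hy : ∀ k < n, y k = y' k) (h : ∀ k ≤ n, γ k = γ' k) :
    cost f n y γ = cost f n y' γ' := by
  rw [cost, cost, kinetic_congr h]
  congr 1
  refine Finset.sum_congr rfl fun k hk => ?_
  rw [Finset.mem_range] at hk
  rw [hy k hk, h (k + 1) hk]

lemma minCost_congr (hy : ∀ k < n, y k = y' k) : minCost f n y = minCost f n y' := by
  simp only [minCost, costValues, cost_congr (f := f) hy fun k _ => rfl]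

lemma cost_add : cost f (m + n) y γ = cost f m y γ + cost f n (later m y) (later m γ) := by
  simp only [cost, kinetic, later, Finset.sum_range_add]
  simp only [add_assoc]
  ring

lemma kinetic_nonneg : 0 ≤ kinetic n γ := Finset.sum_nonneg fun _ _ => sq_nonneg _

lemma kinetic_succ : kinetic (n + 1) γ = kinetic n γ + (γ (n + 1) - γ n) ^ 2 :=
  Finset.sum_range_succ _ _

lemma cost_succ : cost f (n + 1) y γ =
    cost f n y γ + 1 / 2 * (γ (n + 1) - γ n) ^ 2 + f (y n) (γ (n + 1)) := by
  simp only [cost, kinetic_succ, Finset.sum_range_succ]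
  ring

/-- Cauchy–Schwarz on the increments: bounded energy confines the path. -/
lemma sq_le_mul_kinetic (h0 : γ 0 = 0) {k : ℕ} (hk : k ≤ n) : γ k ^ 2 ≤ n * kinetic n γ := by
  have h1 : γ k = ∑ j ∈ Finset.range k, (γ (j + 1) - γ j) := by
    rw [Finset.sum_range_sub, h0, sub_zero]
  have h2 := sq_sum_le_card_mul_sum_sq (s := Finset.range k) (f := fun j => γ (j + 1) - γ j)
  rw [← h1, Finset.card_range] at h2
  refine h2.trans (mul_le_mul (by exact_mod_cast hk) ?_ (Finset.sum_nonneg fun _ _ => sq_nonneg _)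
    (by positivity))
  exact Finset.sum_le_sum_of_subset_of_nonneg (Finset.range_mono hk) fun _ _ _ => sq_nonneg _

lemma continuous_cost (hf : ∀ e, Continuous (f e)) (n : ℕ) (y : ℕ → E) :
    Continuous (cost f n y) := by
  unfold cost kinetic
  fun_prop

/-- The path pinned to `0` at times `0` and `n`. -/
def pin (n : ℕ) (γ : ℕ → ℝ) : ℕ → ℝ := fun k => if k = 0 ∨ k = n then 0 else γ k

lemma continuous_pin (n : ℕ) : Continuous (pin n) := by
  refine continuous_pi fun k => ?_
  unfold pin
  split_ifs <;> fun_prop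

/-- Pinning parametrises the bridges by the separable space `ℕ → ℝ`, so the least cost becomes a
countable infimum, hence measurable in `y`. -/
lemma costValues_eq_range (f : E → ℝ → ℝ) (n : ℕ) (y : ℕ → E) :
    costValues f n y = Set.range (cost f n y ∘ pin n) := by
  ext c
  constructor
  · rintro ⟨γ, h0, hn, rfl⟩
    refine ⟨γ, cost_congr (fun k _ => rfl) fun k _ => ?_⟩
    unfold pin
    split_ifs with h
    · rcases h with rfl | rfl
      exacts [h0.symm, hn.symm]
    · rfl
  · rintro ⟨γ, rfl⟩
    exact ⟨pin n γ, by simp [pin], by simp [pin], rfl⟩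

lemma minCost_eq_iInf (hf : ∀ e, Continuous (f e)) (n : ℕ) (y : ℕ → E) :
    minCost f n y = ⨅ i, cost f n y (pin n (TopologicalSpace.denseSeq (ℕ → ℝ) i)) := by
  rw [minCost, costValues_eq_range, ← Real.sInf_range_comp_denseRange
    ((continuous_cost hf n y).comp (continuous_pin n)) (TopologicalSpace.denseRange_denseSeq _)]
  rfl

lemma measurable_minCost [MeasurableSpace E] (hf : ∀ e, Continuous (f e))
    (hm : ∀ x, Measurable fun e => f e x) (n : ℕ) : Measurable (minCost f n) := by
  rw [funext (minCost_eq_iInf hf n)]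
  refine Measurable.iInf fun i => ?_
  unfold cost
  refine measurable_const.add (Finset.measurable_fun_sum _ fun k _ => ?_)
  exact (hm _).comp (measurable_pi_apply k)

/-- A coercive cost attains its minimum. -/
lemma isLeast_minCost (hf : ∀ e, Continuous (f e)) {L : ℝ}
    (hL : ∀ γ : ℕ → ℝ, γ 0 = 0 → γ n = 0 → 1 / 4 * kinetic n γ + L ≤ cost f n y γ) :
    IsLeast (costValues f n y) (minCost f n y) := by
  -- A path leaving `[-R, R]` has `R ≤ R ^ 2 ≤ n * kinetic`, so its energy is at least `4 * (|cost f
  -- n y 0| + |L| + 1)` and by `hL` it costs more than the zero path. The final `+ 1` ensures `1 ≤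
  -- R`.
  obtain ⟨R, hR⟩ := exists_nat_ge (4 * n * (|cost f n y 0| + |L| + 1) + 1)
  have hR1 : (1 : ℝ) ≤ R := le_trans (le_add_of_nonneg_left (by positivity)) hR
  let K : Set (ℕ → ℝ) := (Set.univ.pi fun _ => Set.Icc (-(R : ℝ)) R) ∩ {γ | γ 0 = 0 ∧ γ n = 0}
  have hK : IsCompact K := (isCompact_univ_pi fun _ => isCompact_Icc).inter_right
    ((isClosed_eq (continuous_apply 0) continuous_const).inter
      (isClosed_eq (continuous_apply n) continuous_const))
  have h0K : (0 : ℕ → ℝ) ∈ K := ⟨fun k _ => ⟨by simp, by simp⟩, rfl, rfl⟩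
  obtain ⟨γ, hγK, hγ⟩ := hK.exists_isMinOn ⟨0, h0K⟩ (continuous_cost hf n y).continuousOn
  have hleast : IsLeast (costValues f n y) (cost f n y γ) := by
    refine ⟨⟨γ, hγK.2.1, hγK.2.2, rfl⟩, ?_⟩
    rintro _ ⟨δ, hδ0, hδn, rfl⟩
    by_cases hδ : ∀ k ≤ n, |δ k| ≤ R
    -- Values after time `n` do not affect the cost but could leave `K`; they are reset to 0.
    · have h1 : (fun k => if k ≤ n then δ k else 0) ∈ K := by
        refine ⟨fun k _ => ?_, by simp [hδ0], by simp [hδn]⟩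
        by_cases hk : k ≤ n
        · simp only [hk, if_true]; exact abs_le.1 (hδ k hk)
        · simp [hk]
      refine (hγ h1).trans_eq (cost_congr (fun k _ => rfl) fun k hk => ?_)
      simp [hk]
    · push Not at hδ
      obtain ⟨k, hk, hkR⟩ := hδ
      have h1 := sq_le_mul_kinetic hδ0 hk
      have h2 : (R : ℝ) ≤ n * kinetic n δ := by
        have : (R : ℝ) ^ 2 ≤ δ k ^ 2 := by
          rw [← sq_abs (δ k)]; gcongr
        nlinarith
      have h3 : 4 * (|cost f n y 0| + |L| + 1) ≤ kinetic n δ := by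
        by_contra h
        push Not at h
        have := mul_le_mul_of_nonneg_left h.le (Nat.cast_nonneg (α := ℝ) n)
        linarith
      have h4 : cost f n y γ ≤ cost f n y 0 := hγ h0K
      have h5 := hL δ hδ0 hδn
      linarith [le_abs_self (cost f n y 0), neg_abs_le L]
  rw [minCost, hleast.csInf_eq]
  exact hleast

lemma minCost_le_sum (hb : BddBelow (costValues f n y)) :
    minCost f n y ≤ ∑ k ∈ Finset.range n, f (y k) 0 := by
  refine csInf_le hb ⟨0, rfl, rfl, ?_⟩
  simp [cost, kinetic]

/-- Two minimisers, both at 0 at the junction, concatenate to a competitor. -/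
lemma minCost_add_le (hm : IsLeast (costValues f m y) (minCost f m y))
    (hn : IsLeast (costValues f n (later m y)) (minCost f n (later m y)))
    (hb : BddBelow (costValues f (m + n) y)) :
    minCost f (m + n) y ≤ minCost f m y + minCost f n (later m y) := by
  obtain ⟨γ, hγ0, hγm, hγ⟩ := hm.1
  obtain ⟨δ, hδ0, hδn, hδ⟩ := hn.1
  let η : ℕ → ℝ := fun k => if k ≤ m then γ k else δ (k - m)
  have h2 : later m η = δ := by
    funext k
    simp only [later, η]
    split_ifs with h
    · obtain rfl : k = 0 := by omega
      simp [hγm, hδ0]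
    · simp
  refine csInf_le hb ⟨η, by simp [η, hγ0], (congrFun h2 n).trans hδn, ?_⟩
  rw [cost_add, h2, hδ, ← hγ]
  congr 1
  exact cost_congr (fun k _ => rfl) fun k hk => by simp [η, hk]

end Bridge

/-! ### The discretised partition function and its expected growth -/

namespace Bridge

variable {E : Type*} {f : E → ℝ → ℝ} {g : E → ℤ → ℝ}

/-- The weight of a jump across `d` unit cells. -/
def jumpWeight (d : ℤ) : ENNReal :=
  ENNReal.ofReal (Real.exp (-(1 / 4 * (max (|(d : ℝ)| - 1) 0) ^ 2)))

lemma tsum_jumpWeight_ne_top : ∑' d, jumpWeight d ≠ ⊤ := by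
  refine Summable.tsum_ofReal_ne_top ?_
  have h : Summable fun d : ℤ => Real.exp 2 * Real.exp (-(|(d : ℝ)|) / 2) := by
    refine Summable.mul_left _ ?_
    have h1 : Summable fun k : ℕ => Real.exp (-((k : ℝ)) / 2) := by
      have := Real.summable_exp_nat_mul_iff.2 (show (-1 / 2 : ℝ) < 0 by norm_num)
      refine this.congr fun k => ?_
      congr 1; ring
    refine Summable.of_nat_of_neg ?_ ?_
    · simpa using h1
    · simpa using h1
  refine h.of_nonneg_of_le (fun d => (Real.exp_pos _).le) fun d => ?_
  rw [← Real.exp_add, Real.exp_le_exp]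
  rcases le_total (|(d : ℝ)| - 1) 0 with h0 | h0
  · rw [max_eq_right h0]; linarith
  · rw [max_eq_left h0]; nlinarith [sq_nonneg (|(d : ℝ)| - 2)]

/-- The partition function over discretized paths from `0`, of length `n` and with given
endpoint. -/
def partition (g : E → ℤ → ℝ) : ℕ → (ℕ → E) → ℤ → ENNReal
  | 0, _, j => if j = 0 then 1 else 0
  | n + 1, y, j => ∑' i, partition g n y i * jumpWeight (j - i) *
      ENNReal.ofReal (Real.exp (g (y n) j))

lemma partition_congr {n : ℕ} {y y' : ℕ → E} (h : ∀ k < n, y k = y' k) (j : ℤ) :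
    partition g n y j = partition g n y' j := by
  induction n generalizing j with
  | zero => rfl
  | succ n ih =>
    simp only [partition, h n (Nat.lt_succ_self n), ih fun k hk => h k (hk.trans n.lt_succ_self)]

lemma abs_floor_sub_le (a b : ℝ) : max (|((⌊a⌋ - ⌊b⌋ : ℤ) : ℝ)| - 1) 0 ≤ |a - b| := by
  refine max_le ?_ (abs_nonneg _)
  rw [sub_le_iff_le_add, abs_le]
  have h1 := Int.floor_le a
  have h2 := Int.lt_floor_add_one a
  have h3 := Int.floor_le b
  have h4 := Int.lt_floor_add_one b
  have h5 := le_abs_self (a - b)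
  have h6 := neg_abs_le (a - b)
  push_cast
  constructor <;> linarith

/-- The cells visited by `γ` give a single term of the partition sum. Half of the kinetic term, `1 /
4 * kinetic`, pays for the jump weights; the other half is kept for coercivity in `le_cost`. -/
lemma ofReal_exp_le_partition (hfg : ∀ e x, |f e x| ≤ g e ⌊x⌋) (n : ℕ) (y : ℕ → E)
    {γ : ℕ → ℝ} (h0 : γ 0 = 0) :
    ENNReal.ofReal (Real.exp (-(cost f n y γ - 1 / 4 * kinetic n γ))) ≤
      partition g n y ⌊γ n⌋ := by
  induction n with
  | zero => simp [partition, h0, cost, kinetic]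
  | succ n ih =>
    rw [partition]
    refine le_trans ?_ (ENNReal.le_tsum ⌊γ n⌋)
    rw [cost_succ, kinetic_succ]
    have e1 : -(cost f n y γ + 1 / 2 * (γ (n + 1) - γ n) ^ 2 + f (y n) (γ (n + 1)) -
        1 / 4 * (kinetic n γ + (γ (n + 1) - γ n) ^ 2)) =
        -(cost f n y γ - 1 / 4 * kinetic n γ) + -(1 / 4 * (γ (n + 1) - γ n) ^ 2) +
        -f (y n) (γ (n + 1)) := by ring
    rw [e1, Real.exp_add, Real.exp_add, ENNReal.ofReal_mul (by positivity),
      ENNReal.ofReal_mul (by positivity)]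
    refine mul_le_mul' (mul_le_mul' ih ?_) ?_
    · refine ENNReal.ofReal_le_ofReal (Real.exp_le_exp.2 ?_)
      have h := abs_floor_sub_le (γ (n + 1)) (γ n)
      have := pow_le_pow_left₀ (le_max_right _ _) h 2
      rw [sq_abs] at this
      linarith
    · refine ENNReal.ofReal_le_ofReal (Real.exp_le_exp.2 ?_)
      exact (neg_le_abs _).trans (hfg _ _)

variable [MeasurableSpace E]

/-- The law of an i.i.d. sequence with marginal `Q`. -/
abbrev iidLaw (Q : Measure E) [IsProbabilityMeasure Q] : Measure (ℕ → E) :=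
  Measure.infinitePi fun _ => Q

variable {Q : Measure E}

/-- A random field `f`, with law governed by `Q`, that is continuous in space and controlled by
unit cells with uniformly bounded exponential moments. -/
structure ControlledField (Q : Measure E) (f : E → ℝ → ℝ) (g : E → ℤ → ℝ) : Prop where
  measurable_field : ∀ x, Measurable fun e => f e x
  continuous_field : ∀ e, Continuous (f e)
  measurable_bound : ∀ i, Measurable fun e => g e i
  abs_le : ∀ e x, |f e x| ≤ g e ⌊x⌋
  exp_moment : ∃ K : ENNReal, K ≠ ⊤ ∧ ∀ i, ∫⁻ e, ENNReal.ofReal (Real.exp (g e i)) ∂Q ≤ K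

namespace ControlledField

lemma le_cost (h : ControlledField Q f g) {n : ℕ} {y : ℕ → E} (hy : partition g n y 0 ≠ ⊤)
    {γ : ℕ → ℝ} (h0 : γ 0 = 0) (hn : γ n = 0) :
    1 / 4 * kinetic n γ + -Real.log (partition g n y 0).toReal ≤ cost f n y γ := by
  have h1 := ofReal_exp_le_partition h.abs_le n y h0
  rw [hn, Int.floor_zero, ENNReal.ofReal_le_iff_le_toReal hy] at h1
  have h2 := (Real.le_log_iff_exp_le ((Real.exp_pos _).trans_le h1)).2 h1
  linarith

lemma isLeast (h : ControlledField Q f g) {n : ℕ} {y : ℕ → E} (hy : partition g n y 0 ≠ ⊤) :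
    IsLeast (costValues f n y) (minCost f n y) :=
  isLeast_minCost h.continuous_field fun _ h0 hn => h.le_cost hy h0 hn

lemma exp_minCost_le (h : ControlledField Q f g) {n : ℕ} {y : ℕ → E}
    (hy : partition g n y 0 ≠ ⊤) :
    ENNReal.ofReal (Real.exp (-minCost f n y)) ≤ ∑' j, partition g n y j := by
  obtain ⟨γ, h0, hn, hγ⟩ := (h.isLeast hy).1
  rw [← hγ]
  have h1 := ofReal_exp_le_partition h.abs_le n y h0
  rw [hn, Int.floor_zero] at h1
  refine le_trans (ENNReal.ofReal_le_ofReal (Real.exp_le_exp.2 ?_))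
    (h1.trans (ENNReal.le_tsum 0))
  linarith [kinetic_nonneg (n := n) (γ := γ)]

end ControlledField

variable [IsProbabilityMeasure Q]

@[fun_prop]
lemma measurable_later (m : ℕ) : Measurable (later (E := E) m) :=
  measurable_pi_lambda _ fun k => measurable_pi_apply (m + k)

lemma measurePreserving_later (m : ℕ) : MeasurePreserving (later m) (iidLaw Q) (iidLaw Q) := by
  refine ⟨measurable_later m, ?_⟩
  refine Measure.eq_infinitePi _ fun s t ht => ?_
  rw [Measure.map_apply (measurable_later m)
    (MeasurableSet.pi s.countable_toSet fun i _ => ht i)]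
  have : later m ⁻¹' (s : Set ℕ).pi t =
      ((s.map (addLeftEmbedding m) : Finset ℕ) : Set ℕ).pi fun k => t (k - m) := by
    ext y
    simp [later, Set.mem_pi]
  rw [this, Measure.infinitePi_pi _ (fun i _ => ht _), Finset.prod_map]
  simp

/-- The past up to time `n` and the future from time `n` on are independent. -/
lemma lintegral_mul_later {n : ℕ} {F G : (ℕ → E) → ENNReal} (hF : Measurable F)
    (hG : Measurable G) (hdep : ∀ y y' : ℕ → E, (∀ k < n, y k = y' k) → F y = F y') :
    ∫⁻ y, F y * G (later n y) ∂(iidLaw Q) = (∫⁻ y, F y ∂(iidLaw Q)) * ∫⁻ y, G y ∂(iidLaw Q) := by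
  obtain ⟨e⟩ : Nonempty E := Q.nonempty_of_neZero
  let m : ℕ → MeasurableSpace (ℕ → E) := fun k => MeasurableSpace.comap (fun y => y k) inferInstance
  have hle (k : ℕ) : m k ≤ MeasurableSpace.pi := (measurable_pi_apply k).comap_le
  have hind : iIndep m (iidLaw Q) := by
    have h := iIndepFun_infinitePi (P := fun _ : ℕ => Q) (X := fun _ e => e)
      (fun _ => measurable_id)
    exact h.iIndep
  have hST := indep_iSup_of_disjoint hle hind (S := {k | k < n}) (T := {k | n ≤ k})
    (Set.disjoint_left.2 fun k (h : k < n) h' => absurd h (not_lt.2 h'))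
  have hcoord (S : Set ℕ) (k : ℕ) (hk : k ∈ S) :
      Measurable[⨆ k ∈ S, m k] fun y : ℕ → E => y k :=
    (comap_measurable _).mono (le_iSup₂_of_le k hk le_rfl) le_rfl
  rw [lintegral_mul_eq_lintegral_mul_lintegral_of_independent_measurableSpace
    (iSup₂_le fun k _ => hle k) (iSup₂_le fun k _ => hle k) hST,
    (measurePreserving_later n).lintegral_comp hG]
  -- Freezing the coordinates from `n` on exhibits `F` as measurable with respect to the past.
  · have : F = F ∘ fun y k => if k < n then y k else e := by
      funext y
      exact hdep _ _ fun k hk => by simp [hk]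
    rw [this]
    refine hF.comp (@measurable_pi_lambda _ _ _ (_) _ _ fun k => ?_)
    split_ifs with hk
    · exact hcoord _ k hk
    · exact measurable_const
  · refine hG.comp (@measurable_pi_lambda _ _ _ (_) _ _ fun k => ?_)
    exact hcoord {k | n ≤ k} (n + k) (Nat.le_add_right n k)

lemma measurable_partition (hg : ∀ i, Measurable fun e => g e i) (n : ℕ) (j : ℤ) :
    Measurable fun y : ℕ → E => partition g n y j := by
  induction n generalizing j with
  | zero => simp only [partition]; exact measurable_const
  | succ n ih =>
    simp only [partition]
    refine Measurable.tsum fun i => ?_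
    refine ((ih i).mul_const _).mul ?_
    exact ((hg j).comp (measurable_pi_apply n)).exp.ennreal_ofReal

/-- The environment of the last step is independent of the past and contributes at most `K`,
uniformly in the cell. Summing over all endpoints leaves the total jump weight, so each step
multiplies the bound by the same factor. -/
lemma lintegral_tsum_partition_le (hg : ∀ i, Measurable fun e => g e i) {K : ENNReal}
    (hK : ∀ i, ∫⁻ e, ENNReal.ofReal (Real.exp (g e i)) ∂Q ≤ K) (n : ℕ) :
    ∫⁻ y, ∑' j, partition g n y j ∂(iidLaw Q) ≤ (K * ∑' d, jumpWeight d) ^ n := by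
  induction n with
  | zero => simp [partition]
  | succ n ih =>
    have hm (i j : ℤ) : Measurable fun y : ℕ → E => partition g n y i * jumpWeight (j - i) :=
      (measurable_partition hg n i).mul_const _
    have hG (j : ℤ) : Measurable fun y : ℕ → E => ENNReal.ofReal (Real.exp (g (y 0) j)) :=
      ((hg j).comp (measurable_pi_apply 0)).exp.ennreal_ofReal
    have hstep (i j : ℤ) : ∫⁻ y, partition g n y i * jumpWeight (j - i) *
        ENNReal.ofReal (Real.exp (g (y n) j)) ∂(iidLaw Q) ≤
        (∫⁻ y, partition g n y i ∂(iidLaw Q)) * jumpWeight (j - i) * K := by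
      have h := lintegral_mul_later (Q := Q) (n := n) (hm i j) (hG j)
        fun y y' hy => by rw [partition_congr hy]
      refine (h.trans_le ?_)
      rw [lintegral_mul_const _ (measurable_partition hg n i)]
      gcongr
      refine le_trans (le_of_eq ?_) (hK j)
      exact (measurePreserving_eval_infinitePi (fun _ : ℕ => Q) 0).lintegral_comp
        (f := fun e => ENNReal.ofReal (Real.exp (g e j))) (hg j).exp.ennreal_ofReal
    simp only [partition]
    have hmul (i j : ℤ) : Measurable fun y : ℕ → E => partition g n y i * jumpWeight (j - i) *
        ENNReal.ofReal (Real.exp (g (y n) j)) :=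
      (hm i j).mul ((hG j).comp (measurable_later n))
    rw [lintegral_tsum fun j => (Measurable.tsum fun i => hmul i j).aemeasurable]
    calc ∑' j, ∫⁻ y, ∑' i, partition g n y i * jumpWeight (j - i) *
          ENNReal.ofReal (Real.exp (g (y n) j)) ∂(iidLaw Q)
        = ∑' j, ∑' i, ∫⁻ y, partition g n y i * jumpWeight (j - i) *
          ENNReal.ofReal (Real.exp (g (y n) j)) ∂(iidLaw Q) := by
          refine tsum_congr fun j => lintegral_tsum fun i => ?_
          exact (hmul i j).aemeasurable
      _ ≤ ∑' j, ∑' i, (∫⁻ y, partition g n y i ∂(iidLaw Q)) * jumpWeight (j - i) * K :=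
          ENNReal.tsum_le_tsum fun j => ENNReal.tsum_le_tsum fun i => hstep i j
      _ = ∑' i, (∫⁻ y, partition g n y i ∂(iidLaw Q)) * (K * ∑' d, jumpWeight d) := by
          rw [ENNReal.tsum_comm]
          refine tsum_congr fun i => ?_
          rw [ENNReal.tsum_mul_right, ENNReal.tsum_mul_left, mul_assoc, mul_comm K]
          congr 2
          exact (Equiv.subRight i).tsum_eq jumpWeight
      _ = (∫⁻ y, ∑' i, partition g n y i ∂(iidLaw Q)) * (K * ∑' d, jumpWeight d) := by
          rw [ENNReal.tsum_mul_right,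
            lintegral_tsum fun i => (measurable_partition hg n i).aemeasurable]
      _ ≤ _ := by rw [pow_succ]; gcongr

namespace ControlledField

lemma exists_rate (h : ControlledField Q f g) : ∃ Λ : ℝ, 0 ≤ Λ ∧ ∀ n,
    ∫⁻ y, ∑' j, partition g n y j ∂(iidLaw Q) ≤ ENNReal.ofReal (Real.exp (Λ * n)) := by
  obtain ⟨K, hK, hKi⟩ := h.exp_moment
  have hfin : K * ∑' d, jumpWeight d ≠ ⊤ := ENNReal.mul_ne_top hK tsum_jumpWeight_ne_top
  -- The per-step factor itself serves as rate, since `x ≤ exp x`.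
  refine ⟨(K * ∑' d, jumpWeight d).toReal, ENNReal.toReal_nonneg, fun n => ?_⟩
  refine (lintegral_tsum_partition_le h.measurable_bound hKi n).trans ?_
  rw [mul_comm _ (n : ℝ), Real.exp_nat_mul, ENNReal.ofReal_pow (Real.exp_pos _).le]
  gcongr
  refine (ENNReal.le_ofReal_iff_toReal_le hfin (Real.exp_pos _).le).2 ?_
  linarith [Real.add_one_le_exp (K * ∑' d, jumpWeight d).toReal]

lemma ae_partition_ne_top (h : ControlledField Q f g) :
    ∀ᵐ y ∂(iidLaw Q), ∀ m n : ℕ, partition g n (later m y) 0 ≠ ⊤ := by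
  obtain ⟨Λ, -, hΛ⟩ := h.exists_rate
  rw [ae_all_iff]; intro m
  rw [ae_all_iff]; intro n
  have hfin : ∀ᵐ y ∂(iidLaw Q), ∑' j, partition g n y j < ⊤ :=
    ae_lt_top (Measurable.tsum fun j => measurable_partition h.measurable_bound n j)
      ((hΛ n).trans_lt ENNReal.ofReal_lt_top).ne
  filter_upwards [(measurePreserving_later m).quasiMeasurePreserving.ae hfin] with y hy
  exact ((ENNReal.le_tsum 0).trans_lt hy).ne

end ControlledField

end Bridge

/-! ### Analytic tools: summable variances, interpolation, Scheffé, Fekete -/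

/-- The variance part of a sequence of second moments that at most half-contracts is summable. -/
lemma summable_sub_of_le_half_add {a b : ℕ → ℝ} (hb : ∀ k, 0 ≤ b k) (hab : ∀ k, b k ≤ a k)
    (h : ∀ k, a (k + 1) ≤ a k / 2 + b k / 2) : Summable fun k => a k - b k := by
  have key (K : ℕ) : ∑ k ∈ Finset.range K, (a k - b k) + 2 * a K ≤ 2 * a 0 := by
    induction K with
    | zero => simp
    | succ K ih => rw [Finset.sum_range_succ]; linarith [h K]
  refine summable_of_sum_range_le (c := 2 * a 0) (fun k => sub_nonneg.2 (hab k)) fun K => ?_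
  linarith [key K, (hb K).trans (hab K)]

/-- A monotone sequence that grows linearly along all sequences `m * 2 ^ k` grows linearly. -/
lemma tendsto_div_of_monotone_of_tendsto_mul_two_pow {u : ℕ → ℝ} {l : ℝ} (hu : Monotone u)
    (h : ∀ m : ℕ, 1 ≤ m →
      Tendsto (fun k : ℕ => u (m * 2 ^ k) / ((m * 2 ^ k : ℕ) : ℝ)) atTop (𝓝 l)) :
    Tendsto (fun n : ℕ => u n / n) atTop (𝓝 l) := by
  refine tendsto_div_of_monotone_of_exists_subseq_tendsto_div u l hu fun a ha => ?_
  obtain ⟨M, hM⟩ := exists_nat_gt (1 / (a - 1))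
  have ha' : 0 < a - 1 := sub_pos.2 ha
  have hM0 : 0 < M := by
    have : (0 : ℝ) < M := (by positivity : (0 : ℝ) < 1 / (a - 1)).trans hM
    exact_mod_cast this
  have hMa : (M : ℝ) + 1 ≤ a * M := by
    rw [div_lt_iff₀ ha'] at hM
    linarith
  have hdiv : Tendsto (fun n => n / M) atTop atTop := Nat.tendsto_div_const_atTop hM0.ne'
  -- The sequences `(M + r) * 2 ^ k`, `r < M`, are enumerated in increasing order. Consecutive
  -- ratios are at most `1 + 1 / M ≤ a`.
  refine ⟨fun n => (M + n % M) * 2 ^ (n / M), Eventually.of_forall fun n => ?_, ?_, ?_⟩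
  · have hstep : (M + (n + 1) % M) * 2 ^ ((n + 1) / M) ≤ (M + n % M + 1) * 2 ^ (n / M) := by
      have hlt := Nat.mod_lt n hM0
      -- At wrap-around the next term is `M * 2 ^ (k + 1) = (2 * M) * 2 ^ k`, which still fits the
      -- pattern.
      by_cases hc : n % M + 1 = M
      · have hn : n + 1 = M * (n / M + 1) := by
          have := Nat.div_add_mod n M
          rw [mul_add, mul_one]; omega
        have h1 : (n + 1) / M = n / M + 1 := by
          rw [hn, Nat.mul_div_cancel_left _ hM0]
        have h2 : (n + 1) % M = 0 := by rw [hn, Nat.mul_mod_right]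
        rw [h1, h2, pow_succ, add_assoc, hc]
        apply le_of_eq; ring
      · have hn : n + 1 = (n % M + 1) + M * (n / M) := by
          have := Nat.div_add_mod n M
          omega
        have h1 : (n + 1) / M = n / M := by
          rw [hn, Nat.add_mul_div_left _ _ hM0, Nat.div_eq_of_lt (by omega), zero_add]
        have h2 : (n + 1) % M = n % M + 1 := by
          rw [hn, Nat.add_mul_mod_self_left, Nat.mod_eq_of_lt (by omega)]
        rw [h1, h2, add_assoc]
    have hstep' : (((M + (n + 1) % M) * 2 ^ ((n + 1) / M) : ℕ) : ℝ) ≤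
        ((M : ℝ) + (n % M : ℕ) + 1) * 2 ^ (n / M) := by exact_mod_cast hstep
    refine hstep'.trans ?_
    push_cast
    rw [← mul_assoc]
    gcongr
    have : (0 : ℝ) ≤ ((n % M : ℕ) : ℝ) := Nat.cast_nonneg _
    nlinarith
  · refine tendsto_atTop_mono (fun n => ?_) hdiv
    calc n / M ≤ 2 ^ (n / M) := Nat.lt_two_pow_self.le
      _ ≤ (M + n % M) * 2 ^ (n / M) := Nat.le_mul_of_pos_left _ (by omega)
  · rw [Metric.tendsto_atTop]
    intro ε hε
    have hev : ∀ᶠ k in atTop, ∀ r ∈ Finset.range M,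
        dist (u ((M + r) * 2 ^ k) / (((M + r) * 2 ^ k : ℕ) : ℝ)) l < ε := by
      rw [Filter.eventually_all_finset]
      intro r _
      exact (h (M + r) (by omega)).eventually (Metric.ball_mem_nhds l hε)
    obtain ⟨n₀, hn₀⟩ := eventually_atTop.1 (hdiv.eventually hev)
    exact ⟨n₀, fun n hn => hn₀ n hn (n % M) (Finset.mem_range.2 (Nat.mod_lt n hM0))⟩

namespace MeasureTheory

variable {Ω : Type*} {mΩ : MeasurableSpace Ω} {μ : Measure Ω}

/-- Borel–Cantelli in its Tonelli form: a series with finite expectation converges almost surely, so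
its terms vanish. -/
lemma ae_tendsto_zero_of_tsum_lintegral_ne_top {F : ℕ → Ω → ENNReal}
    (hF : ∀ k, AEMeasurable (F k) μ) (h : ∑' k, ∫⁻ ω, F k ω ∂μ ≠ ⊤) :
    ∀ᵐ ω ∂μ, Tendsto (fun k => F k ω) atTop (𝓝 0) := by
  rw [← lintegral_tsum hF] at h
  filter_upwards [ae_lt_top' (AEMeasurable.tsum hF) h] with ω hω
  rw [← Nat.cofinite_eq_atTop]
  exact ENNReal.tendsto_cofinite_zero_of_tsum_ne_top hω.ne

lemma ae_tendsto_zero_of_summable_integral_sq {W : ℕ → Ω → ℝ} (hW : ∀ k, MemLp (W k) 2 μ)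
    (h : Summable fun k => ∫ ω, W k ω ^ 2 ∂μ) :
    ∀ᵐ ω ∂μ, Tendsto (fun k => W k ω) atTop (𝓝 0) := by
  have h1 := ae_tendsto_zero_of_tsum_lintegral_ne_top (μ := μ)
    (F := fun k ω => ENNReal.ofReal (W k ω ^ 2))
    (fun k => ((hW k).aestronglyMeasurable.aemeasurable.pow_const 2).ennreal_ofReal) ?_
  · filter_upwards [h1] with ω hω
    have h2 := (ENNReal.tendsto_toReal ENNReal.zero_ne_top).comp hω
    simp only [Function.comp_def, ENNReal.toReal_ofReal (sq_nonneg _), ENNReal.toReal_zero] at h2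
    have h3 := h2.sqrt
    simp only [Real.sqrt_sq_eq_abs, Real.sqrt_zero] at h3
    exact (tendsto_zero_iff_abs_tendsto_zero _).2 h3
  · have : ∀ k, ∫⁻ ω, ENNReal.ofReal (W k ω ^ 2) ∂μ = ENNReal.ofReal (∫ ω, W k ω ^ 2 ∂μ) :=
      fun k => (ofReal_integral_eq_lintegral_ofReal (hW k).integrable_sq
        (Eventually.of_forall fun ω => sq_nonneg _)).symm
    simp only [this]
    exact h.tsum_ofReal_ne_top

/-- Scheffé's lemma for a constant limit. -/
lemma tendsto_integral_abs_sub_of_nonneg [IsProbabilityMeasure μ] {X : ℕ → Ω → ℝ} {c : ℝ}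
    (hX : ∀ n, Integrable (X n) μ) (h0 : ∀ n ω, 0 ≤ X n ω)
    (hae : ∀ᵐ ω ∂μ, Tendsto (fun n => X n ω) atTop (𝓝 c))
    (hint : Tendsto (fun n => ∫ ω, X n ω ∂μ) atTop (𝓝 c)) :
    Tendsto (fun n => ∫ ω, |X n ω - c| ∂μ) atTop (𝓝 0) := by
  have hc : 0 ≤ c := ge_of_tendsto' hint fun n => integral_nonneg (h0 n)
  have hneg : Tendsto (fun n => ∫ ω, max (c - X n ω) 0 ∂μ) atTop (𝓝 (∫ _, 0 ∂μ)) := by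
    refine tendsto_integral_of_dominated_convergence (fun _ => c)
      (fun n => (((integrable_const c).sub (hX n)).aestronglyMeasurable.sup
        aestronglyMeasurable_const)) (integrable_const c) (fun n => ?_) ?_
    · refine Eventually.of_forall fun ω => ?_
      rw [Real.norm_eq_abs, abs_of_nonneg (le_max_right _ _)]
      exact max_le (by linarith [h0 n ω]) hc
    · filter_upwards [hae] with ω hω
      have := (tendsto_const_nhds (x := c)).sub hω |>.max (tendsto_const_nhds (x := (0 : ℝ)))
      simpa using this
  -- This integrates `|x - c| = (x - c) + 2 * max (c - x) 0`; the last term is dominated by `c`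
  -- because `x ≥ 0`.
  have heq (n : ℕ) : ∫ ω, |X n ω - c| ∂μ =
      (∫ ω, X n ω ∂μ - c) + 2 * ∫ ω, max (c - X n ω) 0 ∂μ := by
    have h1 : Integrable (fun ω => max (c - X n ω) 0) μ :=
      ((integrable_const c).sub (hX n)).pos_part
    have h3 : Integrable (fun ω => X n ω - c) μ := (hX n).sub (integrable_const c)
    have h2 : ∫ ω, X n ω ∂μ - c = ∫ ω, (X n ω - c) ∂μ := by
      rw [integral_sub (hX n) (integrable_const c)]; simp
    rw [h2, ← integral_const_mul, ← integral_add h3 (h1.const_mul 2)]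
    refine integral_congr_ae (Eventually.of_forall fun ω => ?_)
    dsimp only
    rcases le_total (X n ω) c with h | h
    · rw [abs_of_nonpos (by linarith), max_eq_left (by linarith)]; ring
    · rw [abs_of_nonneg (by linarith), max_eq_right (by linarith)]; ring
  simp only [heq]
  have := (hint.sub_const c).add (hneg.const_mul 2)
  simpa using this

end MeasureTheory

/-- Fekete's lemma with the limit written as an infimum over the positive integers. -/
lemma Subadditive.tendsto_iInf_pnat {u : ℕ → ℝ} (hu : Subadditive u)
    (hb : BddBelow (Set.range fun n : ℕ => u n / n)) :
    Tendsto (fun n : ℕ => u n / n) atTop (𝓝 (⨅ n : ℕ+, u n / (n : ℕ))) := by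
  have h := hu.tendsto_lim hb
  have : hu.lim = ⨅ n : ℕ+, u n / (n : ℕ) := by
    rw [Subadditive.lim, iInf]
    congr 1
    ext x
    constructor
    · rintro ⟨n, hn, rfl⟩
      exact ⟨⟨n, hn⟩, rfl⟩
    · rintro ⟨n, rfl⟩
      exact ⟨n, n.pos, rfl⟩
  rwa [this] at h

/-! ### Drift, lower tails and second moments of the least cost -/

namespace Bridge

variable {E : Type*} {f : E → ℝ → ℝ} {g : E → ℤ → ℝ}

@[simp]
lemma later_zero (y : ℕ → E) : later 0 y = y := by
  funext k; simp [later]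

/-- The positive part of the least cost after adding a linear drift. -/
def excess (f : E → ℝ → ℝ) (C : ℝ) (n : ℕ) (y : ℕ → E) : ℝ := max (minCost f n y + C * n) 0

lemma abs_sub_excess_le (C : ℝ) (n : ℕ) (y : ℕ → E) :
    |minCost f n y + C * n - excess f C n y| ≤ Real.exp (-(minCost f n y + C * n)) := by
  rw [excess]
  rcases le_total (minCost f n y + C * n) 0 with h0 | h0
  · rw [max_eq_right h0, sub_zero, abs_of_nonpos h0]
    linarith [Real.add_one_le_exp (-(minCost f n y + C * n))]
  · rw [max_eq_left h0, sub_self, abs_zero]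
    exact (Real.exp_pos _).le

variable [MeasurableSpace E] {Q : Measure E}

namespace ControlledField

lemma measurable_minCost (h : ControlledField Q f g) (n : ℕ) : Measurable (minCost f n) :=
  Bridge.measurable_minCost h.continuous_field h.measurable_field n

lemma bound_nonneg (h : ControlledField Q f g) (e : E) : 0 ≤ g e 0 := by
  have := (abs_nonneg _).trans (h.abs_le e 0)
  rwa [Int.floor_zero] at this

lemma field_zero_le (h : ControlledField Q f g) (e : E) : |f e 0| ≤ g e 0 := by
  have := h.abs_le e 0
  rwa [Int.floor_zero] at this

lemma memLp_bound (h : ControlledField Q f g) : MemLp (fun e => g e 0) 2 Q := by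
  obtain ⟨K, hK, hKi⟩ := h.exp_moment
  have hg := h.measurable_bound 0
  rw [memLp_two_iff_integrable_sq hg.aestronglyMeasurable]
  have hexp : Integrable (fun e => Real.exp (g e 0)) Q := by
    rw [← lintegral_ofReal_ne_top_iff_integrable hg.exp.aestronglyMeasurable
      (Eventually.of_forall fun e => (Real.exp_pos _).le)]
    exact ((hKi 0).trans_lt hK.lt_top).ne
  refine (hexp.const_mul 2).mono' (hg.pow_const 2).aestronglyMeasurable
    (Eventually.of_forall fun e => ?_)
  rw [Real.norm_eq_abs, abs_of_nonneg (sq_nonneg _)]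
  have := Real.quadratic_le_exp_of_nonneg (h.bound_nonneg e)
  linarith [h.bound_nonneg e]

/-- The least cost is dominated by the cost of the constant path. -/
lemma minCost_le_sum_bound (h : ControlledField Q f g) {n : ℕ} {y : ℕ → E}
    (hy : IsLeast (costValues f n y) (minCost f n y)) :
    minCost f n y ≤ ∑ k ∈ Finset.range n, g (y k) 0 :=
  (minCost_le_sum ⟨_, hy.2⟩).trans
    (Finset.sum_le_sum fun k _ => (le_abs_self _).trans (h.field_zero_le (y k)))

lemma measurable_excess (h : ControlledField Q f g) (C : ℝ) (n : ℕ) : Measurable (excess f C n) :=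
  ((h.measurable_minCost n).add_const _).max measurable_const

end ControlledField

variable [IsProbabilityMeasure Q]

/-- With drift `C`, the least costs have exponentially small lower tails. -/
def IsDrift (Q : Measure E) [IsProbabilityMeasure Q] (f : E → ℝ → ℝ) (C : ℝ) : Prop :=
  0 ≤ C ∧ ∀ n : ℕ, ∫⁻ y, ENNReal.ofReal (Real.exp (-(minCost f n y + C * n))) ∂(iidLaw Q) ≤
    ENNReal.ofReal (Real.exp (-n))

namespace ControlledField

lemma ae_isLeast (h : ControlledField Q f g) : ∀ᵐ y ∂(iidLaw Q), ∀ m n : ℕ,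
    IsLeast (costValues f n (later m y)) (minCost f n (later m y)) := by
  filter_upwards [h.ae_partition_ne_top] with y hy m n
  exact h.isLeast (hy m n)

lemma memLp_bound_eval (h : ControlledField Q f g) (k : ℕ) :
    MemLp (fun y : ℕ → E => g (y k) 0) 2 (iidLaw Q) :=
  h.memLp_bound.comp_measurePreserving (measurePreserving_eval_infinitePi (fun _ : ℕ => Q) k)

lemma ae_minCost_add_le (h : ControlledField Q f g) : ∀ᵐ y ∂(iidLaw Q), ∀ m n : ℕ,
    minCost f (m + n) y ≤ minCost f m y + minCost f n (later m y) := by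
  filter_upwards [h.ae_isLeast] with y hy m n
  have h0 n : IsLeast (costValues f n y) (minCost f n y) := by simpa using hy 0 n
  exact minCost_add_le (h0 m) (hy m n) ⟨_, (h0 (m + n)).2⟩

/-- Extending an optimal bridge by one step resting at 0 raises the cost by at most `g (y n) 0`. -/
lemma ae_monotone (h : ControlledField Q f g) : ∀ᵐ y ∂(iidLaw Q),
    Monotone fun n => ∑ k ∈ Finset.range n, g (y k) 0 - minCost f n y := by
  filter_upwards [h.ae_isLeast, h.ae_minCost_add_le] with y hy hadd
  refine monotone_nat_of_le_succ fun n => ?_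
  have h1 := hadd n 1
  have h2 := h.minCost_le_sum_bound (hy n 1)
  rw [Finset.sum_range_one] at h2
  have h3 : later n y 0 = y n := rfl
  rw [h3] at h2
  rw [Finset.sum_range_succ]
  linarith

lemma exists_drift (h : ControlledField Q f g) : ∃ C : ℝ, IsDrift Q f C := by
  obtain ⟨Λ, hΛ0, hΛ⟩ := h.exists_rate
  -- `Λ` cancels the growth of the partition function; the extra 1 leaves `exp (-n)`, summable in
  -- `n`.
  refine ⟨Λ + 1, by positivity, fun n => ?_⟩
  have hm := h.measurable_minCost n
  have h1 : ∫⁻ y, ENNReal.ofReal (Real.exp (-minCost f n y)) ∂(iidLaw Q) ≤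
      ENNReal.ofReal (Real.exp (Λ * n)) := by
    refine le_trans (lintegral_mono_ae ?_) (hΛ n)
    filter_upwards [h.ae_partition_ne_top] with y hy
    exact h.exp_minCost_le (by simpa using hy 0 n)
  have h2 (y : ℕ → E) : ENNReal.ofReal (Real.exp (-(minCost f n y + (Λ + 1) * n))) =
      ENNReal.ofReal (Real.exp (-minCost f n y)) * ENNReal.ofReal (Real.exp (-((Λ + 1) * n))) := by
    rw [← ENNReal.ofReal_mul (Real.exp_pos _).le, ← Real.exp_add, neg_add]
  simp only [h2]
  rw [lintegral_mul_const _ (by fun_prop)]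
  refine (mul_le_mul_left h1 _).trans_eq ?_
  rw [← ENNReal.ofReal_mul (Real.exp_pos _).le, ← Real.exp_add]
  congr 2
  ring

lemma integrable_exp (h : ControlledField Q f g) {C : ℝ} (hC : IsDrift Q f C)
    (n : ℕ) :     Integrable (fun y => Real.exp (-(minCost f n y + C * n))) (iidLaw Q) := by
  have hm := h.measurable_minCost n
  rw [← lintegral_ofReal_ne_top_iff_integrable (by fun_prop)
    (Eventually.of_forall fun e => (Real.exp_pos _).le)]
  exact ((hC.2 n).trans_lt ENNReal.ofReal_lt_top).ne

lemma integral_exp_le (h : ControlledField Q f g) {C : ℝ} (hC : IsDrift Q f C)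
    (n : ℕ) :     ∫ y, Real.exp (-(minCost f n y + C * n)) ∂(iidLaw Q) ≤ Real.exp (-n) := by
  rw [← ENNReal.ofReal_le_ofReal_iff (Real.exp_pos _).le,
    ofReal_integral_eq_lintegral_ofReal (h.integrable_exp hC n)
      (Eventually.of_forall fun e => (Real.exp_pos _).le)]
  exact hC.2 n

lemma memLp_excess (h : ControlledField Q f g) {C : ℝ} (hC : IsDrift Q f C)
    (n : ℕ) : MemLp (excess f C n) 2 (iidLaw Q) := by
  have h1 : MemLp (fun y : ℕ → E => ∑ k ∈ Finset.range n, g (y k) 0 + C * n) 2 (iidLaw Q) :=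
    (memLp_finsetSum _ fun k _ => h.memLp_bound_eval k).add (memLp_const _)
  refine h1.mono' (h.measurable_excess C n).aestronglyMeasurable ?_
  filter_upwards [h.ae_isLeast] with y hy
  have h2 := h.minCost_le_sum_bound (by simpa using hy 0 n : IsLeast (costValues f n y) _)
  have h3 : 0 ≤ ∑ k ∈ Finset.range n, g (y k) 0 :=
    Finset.sum_nonneg fun k _ => h.bound_nonneg (y k)
  rw [Real.norm_eq_abs, excess, abs_of_nonneg (le_max_right _ _)]
  have hC0 := hC.1
  exact max_le (by linarith) (by positivity)

lemma integrable_minCost_sub_excess (h : ControlledField Q f g) {C : ℝ} (hC : IsDrift Q f C)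
    (n : ℕ) :     Integrable (fun y => minCost f n y + C * n - excess f C n y) (iidLaw Q) :=
  (h.integrable_exp hC n).mono' ((((h.measurable_minCost n).add_const _).sub
    (h.measurable_excess C n)).aestronglyMeasurable)
    (Eventually.of_forall fun y => abs_sub_excess_le C n y)

lemma integrable_minCost (h : ControlledField Q f g) {C : ℝ} (hC : IsDrift Q f C)
    (n : ℕ) : Integrable (minCost f n) (iidLaw Q) := by
  have h1 := ((h.integrable_minCost_sub_excess hC n).add
    ((h.memLp_excess hC n).integrable one_le_two)).sub (integrable_const (C * n))
  refine h1.congr (Eventually.of_forall fun y => ?_)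
  simp

lemma abs_integral_sub_excess_le (h : ControlledField Q f g) {C : ℝ} (hC : IsDrift Q f C)
    (n : ℕ) :     |∫ y, minCost f n y ∂(iidLaw Q) + C * n - ∫ y, excess f C n y ∂(iidLaw Q)| ≤ 1 := by
  have h1 : ∫ y, minCost f n y ∂(iidLaw Q) + C * n - ∫ y, excess f C n y ∂(iidLaw Q) =
      ∫ y, (minCost f n y + C * n - excess f C n y) ∂(iidLaw Q) := by
    have hi : Integrable (fun y => minCost f n y + C * n) (iidLaw Q) :=
      (h.integrable_minCost hC n).add (integrable_const _)
    rw [integral_sub hi ((h.memLp_excess hC n).integrable one_le_two),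
      integral_add (h.integrable_minCost hC n) (integrable_const _)]
    simp
  rw [h1]
  refine (abs_integral_le_integral_abs).trans ?_
  refine (integral_mono (h.integrable_minCost_sub_excess hC n).abs
    (h.integrable_exp hC n) (abs_sub_excess_le C n)).trans ?_
  refine (h.integral_exp_le hC n).trans ?_
  simp

/-- Second moment estimate from independence of consecutive blocks. -/
lemma integral_excess_sq_two_mul_le (h : ControlledField Q f g) {C : ℝ} (hC : IsDrift Q f C)
    (n : ℕ) :
    ∫ y, excess f C (n * 2) y ^ 2 ∂(iidLaw Q) ≤
      2 * ∫ y, excess f C n y ^ 2 ∂(iidLaw Q) + 2 * (∫ y, excess f C n y ∂(iidLaw Q)) ^ 2 := by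
  have hX := h.memLp_excess hC n
  have hmp := measurePreserving_later (Q := Q) n
  have hX' : MemLp (fun y => excess f C n (later n y)) 2 (iidLaw Q) :=
    hX.comp_measurePreserving hmp
  have hm := h.measurable_excess C n
  have hnn (y : ℕ → E) : 0 ≤ excess f C n y := le_max_right _ _
  have hprod : ∫ y, excess f C n y * excess f C n (later n y) ∂(iidLaw Q) =
      (∫ y, excess f C n y ∂(iidLaw Q)) ^ 2 := by
    have hind := lintegral_mul_later (Q := Q) (n := n) hm.ennreal_ofReal hm.ennreal_ofReal
      fun y y' hy => by rw [excess, excess, minCost_congr hy]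
    rw [integral_eq_lintegral_of_nonneg_ae (Eventually.of_forall fun y => mul_nonneg (hnn _) (hnn _))
      (hm.mul (hm.comp (measurable_later n))).aestronglyMeasurable,
      integral_eq_lintegral_of_nonneg_ae (Eventually.of_forall hnn) hm.aestronglyMeasurable]
    simp only [ENNReal.ofReal_mul (hnn _)]
    rw [hind, ENNReal.toReal_mul, sq]
  have hsq' : ∫ y, excess f C n (later n y) ^ 2 ∂(iidLaw Q) =
      ∫ y, excess f C n y ^ 2 ∂(iidLaw Q) := by
    have := integral_map (μ := iidLaw Q) (φ := later n) hmp.measurable.aemeasurable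
      (f := fun y => excess f C n y ^ 2) (hm.pow_const 2).aestronglyMeasurable
    rw [hmp.map_eq] at this
    exact this.symm
  have hmul : Integrable (fun y => 2 * (excess f C n y * excess f C n (later n y))) (iidLaw Q) :=
    (hX.integrable_mul hX').const_mul 2
  calc ∫ y, excess f C (n * 2) y ^ 2 ∂(iidLaw Q)
      ≤ ∫ y, (excess f C n y ^ 2 + excess f C n (later n y) ^ 2 +
          2 * (excess f C n y * excess f C n (later n y))) ∂(iidLaw Q) := by
        refine integral_mono_ae (h.memLp_excess hC _).integrable_sq
          ((hX.integrable_sq.add hX'.integrable_sq).add hmul) ?_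
        filter_upwards [h.ae_minCost_add_le] with y hy
        -- The linear drift is additive and positive parts preserve subadditivity; nonnegativity
        -- then allows squaring.
        have h1 : excess f C (n * 2) y ≤ excess f C n y + excess f C n (later n y) := by
          have h2 := hy n n
          rw [← mul_two] at h2
          refine max_le ?_ (add_nonneg (hnn _) (hnn _))
          have h3 : minCost f n y + C * n ≤ excess f C n y := le_max_left _ _
          have h4 : minCost f n (later n y) + C * n ≤ excess f C n (later n y) := le_max_left _ _
          push_cast
          linarith
        have := pow_le_pow_left₀ (le_max_right _ _ : 0 ≤ excess f C (n * 2) y) h1 2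
        refine this.trans_eq ?_
        ring
    _ = _ := by
        have hadd : Integrable (fun y => excess f C n y ^ 2 + excess f C n (later n y) ^ 2)
            (iidLaw Q) := hX.integrable_sq.add hX'.integrable_sq
        rw [integral_add hadd hmul,
          integral_add hX.integrable_sq hX'.integrable_sq, integral_const_mul, hprod, hsq']
        ring

end ControlledField

end Bridge

/-! ### The law of large numbers for bridges in an i.i.d. environment -/

namespace Bridge

/-- The growth rate of the expected least cost. -/
def growthRate {E : Type*} [MeasurableSpace E] (Q : Measure E) [IsProbabilityMeasure Q]
    (f : E → ℝ → ℝ) : ℝ := ⨅ n : ℕ+, (∫ y, minCost f n y ∂(iidLaw Q)) / (n : ℕ)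

namespace ControlledField

variable {E : Type*} [MeasurableSpace E] {Q : Measure E} [IsProbabilityMeasure Q]
  {f : E → ℝ → ℝ} {g : E → ℤ → ℝ} {C : ℝ}

lemma subadditive_integral (h : ControlledField Q f g) (hC : IsDrift Q f C) :
    Subadditive fun n => ∫ y, minCost f n y ∂(iidLaw Q) := by
  intro m n
  have hmp := measurePreserving_later (Q := Q) m
  have hi : Integrable (fun y => minCost f n (later m y)) (iidLaw Q) :=
    hmp.integrable_comp_of_integrable (h.integrable_minCost hC n)
  have he : ∫ y, minCost f n (later m y) ∂(iidLaw Q) = ∫ y, minCost f n y ∂(iidLaw Q) := by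
    have := integral_map (μ := iidLaw Q) (φ := later m) hmp.measurable.aemeasurable
      (f := minCost f n) (h.measurable_minCost n).aestronglyMeasurable
    rw [hmp.map_eq] at this
    exact this.symm
  dsimp only
  rw [← he, ← integral_add (h.integrable_minCost hC m) hi]
  refine integral_mono_ae (h.integrable_minCost hC _) ((h.integrable_minCost hC m).add hi) ?_
  filter_upwards [h.ae_minCost_add_le] with y hy
  exact hy m n

lemma bddBelow_integral_div (h : ControlledField Q f g) (hC : IsDrift Q f C) :
    BddBelow (Set.range fun n : ℕ => (∫ y, minCost f n y ∂(iidLaw Q)) / n) := by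
  have hC0 := hC.1
  refine ⟨-(C + 1), ?_⟩
  rintro _ ⟨n, rfl⟩
  rcases Nat.eq_zero_or_pos n with rfl | hn
  · simp; linarith
  · have hn' : (1 : ℝ) ≤ n := by exact_mod_cast hn
    have h1 := (_root_.abs_le.1 (h.abs_integral_sub_excess_le hC n)).1
    have h2 : 0 ≤ ∫ y, excess f C n y ∂(iidLaw Q) := integral_nonneg fun y => le_max_right _ _
    dsimp only
    rw [le_div_iff₀ (by linarith)]
    nlinarith

lemma tendsto_integral_div (h : ControlledField Q f g) (hC : IsDrift Q f C) :
    Tendsto (fun n : ℕ => (∫ y, minCost f n y ∂(iidLaw Q)) / n) atTop (𝓝 (growthRate Q f)) :=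
  (h.subadditive_integral hC).tendsto_iInf_pnat (h.bddBelow_integral_div hC)

lemma tendsto_integral_excess_div (h : ControlledField Q f g) (hC : IsDrift Q f C) :
    Tendsto (fun n : ℕ => (∫ y, excess f C n y ∂(iidLaw Q)) / n) atTop
      (𝓝 (growthRate Q f + C)) := by
  have h0 : Tendsto (fun n : ℕ => (∫ y, minCost f n y ∂(iidLaw Q) + C * n -
      ∫ y, excess f C n y ∂(iidLaw Q)) / n) atTop (𝓝 0) := by
    refine squeeze_zero_norm (a := fun n : ℕ => 1 / (n : ℝ)) (fun n => ?_)
      tendsto_one_div_atTop_nhds_zero_nat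
    rw [Real.norm_eq_abs, abs_div, Nat.abs_cast]
    gcongr
    exact h.abs_integral_sub_excess_le hC n
  have h1 := ((h.tendsto_integral_div hC).add_const C).sub h0
  rw [sub_zero] at h1
  refine h1.congr' ?_
  filter_upwards [eventually_gt_atTop 0] with n hn
  have : (n : ℝ) ≠ 0 := by positivity
  field_simp
  ring

/-- The exponentials of `-(minCost + C * n)` have summable means, so they tend to 0; once they are
below 1 the positive part does nothing. -/
lemma ae_eventually_excess_eq (h : ControlledField Q f g) (hC : IsDrift Q f C) :
    ∀ᵐ y ∂(iidLaw Q), ∀ᶠ n : ℕ in atTop, excess f C n y = minCost f n y + C * n := by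
  have h1 := ae_tendsto_zero_of_tsum_lintegral_ne_top (μ := iidLaw Q)
    (F := fun n y => ENNReal.ofReal (Real.exp (-(minCost f n y + C * n))))
    (fun n => by have := h.measurable_minCost n; fun_prop) ?_
  · filter_upwards [h1] with y hy
    filter_upwards [hy.eventually (gt_mem_nhds one_pos)] with n hn
    rw [ENNReal.ofReal_lt_one, Real.exp_lt_one_iff] at hn
    exact max_eq_left (by linarith)
  · refine ne_top_of_le_ne_top ?_ (ENNReal.tsum_le_tsum hC.2)
    refine Summable.tsum_ofReal_ne_top ?_
    have := Real.summable_exp_nat_mul_iff.2 (show (-1 : ℝ) < 0 by norm_num)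
    refine this.congr fun k => ?_
    congr 1; ring

lemma ae_tendsto_excess_mul_two_pow (h : ControlledField Q f g) (hC : IsDrift Q f C) {m : ℕ}
    (hm : 1 ≤ m) : ∀ᵐ y ∂(iidLaw Q), Tendsto (fun k : ℕ => excess f C (m * 2 ^ k) y /
      ((m * 2 ^ k : ℕ) : ℝ)) atTop (𝓝 (growthRate Q f + C)) := by
  let N : ℕ → ℕ := fun k => m * 2 ^ k
  have hN (k : ℕ) : (0 : ℝ) < N k := by
    have : 0 < N k := by positivity
    exact_mod_cast this
  have hNs (k : ℕ) : (N (k + 1) : ℝ) = N k * 2 := by simp only [N]; push_cast; ring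
  have hNs' (k : ℕ) : N (k + 1) = N k * 2 := by simp only [N]; ring
  have hNt : Tendsto N atTop atTop := tendsto_atTop_mono
    (fun k => (Nat.lt_two_pow_self (n := k)).le.trans (Nat.le_mul_of_pos_left _ hm)) tendsto_id
  let e : ℕ → ℝ := fun n => ∫ y, excess f C n y ∂(iidLaw Q)
  let V : ℕ → ℝ := fun n => ∫ y, excess f C n y ^ 2 ∂(iidLaw Q)
  have hvar (n : ℕ) : ∫ y, (excess f C n y - e n) ^ 2 ∂(iidLaw Q) = V n - e n ^ 2 := by
    have h1 := variance_eq_sub (h.memLp_excess hC n)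
    rw [variance_eq_integral (h.memLp_excess hC n).aestronglyMeasurable.aemeasurable] at h1
    exact h1
  have hVe (n : ℕ) : e n ^ 2 ≤ V n := by
    rw [← sub_nonneg, ← hvar]
    exact integral_nonneg fun y => sq_nonneg _
  -- These are the variances of `excess / N k`. Dividing the block estimate by `(2 * N k) ^ 2` gives
  -- exactly the half-contraction required.
  have hsum : Summable fun k => V (N k) / (N k : ℝ) ^ 2 - (e (N k) / N k) ^ 2 := by
    refine summable_sub_of_le_half_add (fun k => sq_nonneg _) (fun k => ?_) fun k => ?_
    · rw [div_pow]
      gcongr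
      exact hVe _
    · have h1 := h.integral_excess_sq_two_mul_le hC (N k)
      rw [← hNs'] at h1
      change V (N (k + 1)) ≤ 2 * V (N k) + 2 * e (N k) ^ 2 at h1
      have hk := hN k
      rw [hNs, div_le_iff₀ (by positivity)]
      refine h1.trans_eq ?_
      field_simp
  have hW := ae_tendsto_zero_of_summable_integral_sq (μ := iidLaw Q)
    (W := fun k y => (excess f C (N k) y - e (N k)) / N k)
    (fun k => by
      simp only [div_eq_mul_inv]
      exact ((h.memLp_excess hC (N k)).sub (memLp_const _)).mul_const _)
    (by
      refine hsum.congr fun k => ?_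
      have h2 : ∫ y, ((excess f C (N k) y - e (N k)) / N k) ^ 2 ∂(iidLaw Q) =
          (V (N k) - e (N k) ^ 2) / (N k : ℝ) ^ 2 := by
        simp_rw [div_pow, integral_div, hvar]
      rw [h2, sub_div, div_pow])
  have he := (h.tendsto_integral_excess_div hC).comp hNt
  filter_upwards [hW] with y hy
  have := hy.add he
  rw [zero_add] at this
  refine this.congr fun k => ?_
  simp only [Function.comp, N, e]
  rw [← add_div, sub_add_cancel]

/-- Almost sure convergence of the normalized least costs. -/
theorem ae_tendsto_minCost_div (h : ControlledField Q f g) :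
    ∀ᵐ y ∂(iidLaw Q), Tendsto (fun n : ℕ => minCost f n y / n) atTop
      (𝓝 (growthRate Q f)) := by
  obtain ⟨C, hC⟩ := h.exists_drift
  have hmeas := h.measurable_bound 0
  have hslln : ∀ᵐ y ∂(iidLaw Q), Tendsto (fun n : ℕ => (∑ k ∈ Finset.range n, g (y k) 0) / n)
      atTop (𝓝 (∫ y, g (y 0) 0 ∂(iidLaw Q))) := by
    have hind : iIndepFun (fun (k : ℕ) (y : ℕ → E) => g (y k) 0) (iidLaw Q) :=
      iIndepFun_infinitePi (P := fun _ : ℕ => Q) (X := fun _ e => g e 0) (fun _ => hmeas)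
    refine strong_law_ae_real (fun k (y : ℕ → E) => g (y k) 0)
      ((h.memLp_bound_eval 0).integrable one_le_two) (fun i j hij => hind.indepFun hij)
      fun i => ?_
    refine ⟨(hmeas.comp (measurable_pi_apply i)).aemeasurable,
      (hmeas.comp (measurable_pi_apply 0)).aemeasurable, ?_⟩
    have key (i : ℕ) : (iidLaw Q).map (fun y : ℕ → E => g (y i) 0) = Q.map fun e => g e 0 := by
      have := Measure.map_map (μ := iidLaw Q) hmeas (measurable_pi_apply i)
      rw [(measurePreserving_eval_infinitePi (fun _ : ℕ => Q) i).map_eq] at this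
      exact this.symm
    rw [key, key]
  have hsub : ∀ᵐ y ∂(iidLaw Q), ∀ m : ℕ, 1 ≤ m →
      Tendsto (fun k : ℕ => excess f C (m * 2 ^ k) y / ((m * 2 ^ k : ℕ) : ℝ)) atTop
        (𝓝 (growthRate Q f + C)) := by
    rw [ae_all_iff]; intro m
    by_cases hm : 1 ≤ m
    · filter_upwards [h.ae_tendsto_excess_mul_two_pow hC hm] with y hy _ using hy
    · exact Eventually.of_forall fun y hm' => absurd hm' hm
  filter_upwards [hslln, hsub, h.ae_monotone, h.ae_eventually_excess_eq hC] with y hS hX hmono hev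
  -- The least cost itself need not be monotone; the sum of bounds minus the least cost is, and the
  -- strong law converts the limit back.
  have hgeo := tendsto_div_of_monotone_of_tendsto_mul_two_pow hmono
    (l := ∫ y, g (y 0) 0 ∂(iidLaw Q) - growthRate Q f) fun m hm => by
    have hNt : Tendsto (fun k => m * 2 ^ k) atTop atTop := tendsto_atTop_mono
      (fun k => (Nat.lt_two_pow_self (n := k)).le.trans (Nat.le_mul_of_pos_left _ hm)) tendsto_id
    have h1 := (hS.comp hNt).sub ((hX m hm).sub_const C)
    rw [add_sub_cancel_right] at h1
    refine h1.congr' ?_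
    filter_upwards [hNt.eventually hev] with k hk
    have hpos : ((m * 2 ^ k : ℕ) : ℝ) ≠ 0 := by positivity
    rw [hk, Function.comp_apply]
    field_simp
    ring
  have h2 := hS.sub hgeo
  rw [sub_sub_cancel] at h2
  refine h2.congr fun n => ?_
  rw [← sub_div, sub_sub_cancel]

/-- Convergence in mean of the normalized least costs. -/
theorem tendsto_integral_abs_minCost_div_sub (h : ControlledField Q f g) :
    Tendsto (fun n : ℕ => ∫ y, |minCost f n y / n - growthRate Q f| ∂(iidLaw Q)) atTop (𝓝 0) := by
  obtain ⟨C, hC⟩ := h.exists_drift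
  have hXi (n : ℕ) : Integrable (fun y => excess f C n y / n) (iidLaw Q) :=
    ((h.memLp_excess hC n).integrable one_le_two).div_const _
  -- The excess, unlike the cost, is nonnegative, so Scheffé applies. The discarded negative part
  -- has mean at most 1 and vanishes after division by `n`.
  have hconv := tendsto_integral_abs_sub_of_nonneg (μ := iidLaw Q)
    (X := fun n y => excess f C n y / n) (c := growthRate Q f + C) hXi
    (fun n y => div_nonneg (le_max_right _ _) (Nat.cast_nonneg _)) ?_ ?_
  · have hsum := hconv.add (tendsto_one_div_atTop_nhds_zero_nat (𝕜 := ℝ))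
    rw [add_zero] at hsum
    refine squeeze_zero' (Eventually.of_forall fun n => integral_nonneg fun y => abs_nonneg _)
      ?_ hsum
    filter_upwards [eventually_gt_atTop 0] with n hn
    have hn0 : (0 : ℝ) < n := by exact_mod_cast hn
    have hd := h.integrable_exp hC n
    have ha : Integrable (fun y => |excess f C n y / n - (growthRate Q f + C)|) (iidLaw Q) :=
      ((hXi n).sub (integrable_const _)).abs
    calc ∫ y, |minCost f n y / n - growthRate Q f| ∂(iidLaw Q)
        ≤ ∫ y, (|excess f C n y / n - (growthRate Q f + C)| +
            Real.exp (-(minCost f n y + C * n)) / n) ∂(iidLaw Q) := by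
          refine integral_mono (((h.integrable_minCost hC n).div_const _).sub
            (integrable_const _)).abs (ha.add (hd.div_const _)) fun y => ?_
          have e1 : minCost f n y / n - growthRate Q f =
              (excess f C n y / n - (growthRate Q f + C)) +
                (minCost f n y + C * n - excess f C n y) / n := by
            field_simp
            ring
          dsimp only
          rw [e1]
          refine (abs_add_le _ _).trans ?_
          gcongr
          rw [abs_div, Nat.abs_cast]
          gcongr
          exact abs_sub_excess_le C n y
      _ = ∫ y, |excess f C n y / n - (growthRate Q f + C)| ∂(iidLaw Q) +
            (∫ y, Real.exp (-(minCost f n y + C * n)) ∂(iidLaw Q)) / n := by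
          rw [integral_add ha (hd.div_const _), integral_div]
      _ ≤ _ := by
          gcongr
          exact (h.integral_exp_le hC n).trans (by simp)
  · filter_upwards [h.ae_tendsto_minCost_div, h.ae_eventually_excess_eq hC] with y hy hev
    refine (hy.add_const C).congr' ?_
    filter_upwards [hev, eventually_gt_atTop 0] with n hn hn0
    have : (n : ℝ) ≠ 0 := by positivity
    rw [hn]
    field_simp
  · simpa only [integral_div] using h.tendsto_integral_excess_div hC

end ControlledField

end Bridge

namespace Bridge.ControlledField

variable {E : Type*} [MeasurableSpace E] {Q : Measure E} {f : E → ℝ → ℝ} {g : E → ℤ → ℝ}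

lemma memLp_field (h : ControlledField Q f g) : MemLp (fun e => f e 0) 2 Q :=
  h.memLp_bound.mono' (h.measurable_field 0).aestronglyMeasurable
    (Eventually.of_forall h.field_zero_le)

variable [IsProbabilityMeasure Q]

/-- The field along the constant path is sublinear. -/
lemma ae_tendsto_field_div (h : ControlledField Q f g) : ∀ᵐ y ∂(iidLaw Q),
    Tendsto (fun k : ℕ => f (y k) 0 / ((k + 1 : ℕ) : ℝ)) atTop (𝓝 0) := by
  have hev (k : ℕ) : MemLp (fun y : ℕ → E => f (y k) 0) 2 (iidLaw Q) :=
    h.memLp_field.comp_measurePreserving (measurePreserving_eval_infinitePi (fun _ : ℕ => Q) k)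
  refine ae_tendsto_zero_of_summable_integral_sq
    (W := fun k (y : ℕ → E) => f (y k) 0 / ((k + 1 : ℕ) : ℝ)) (fun k => ?_) ?_
  · simp only [div_eq_mul_inv]
    exact (hev k).mul_const _
  · have key (k : ℕ) : ∫ y : ℕ → E, (f (y k) 0 / ((k + 1 : ℕ) : ℝ)) ^ 2 ∂(iidLaw Q) =
        (∫ e, f e 0 ^ 2 ∂Q) * (1 / ((k + 1 : ℕ) : ℝ) ^ 2) := by
      have hmp := measurePreserving_eval_infinitePi (fun _ : ℕ => Q) k
      have := integral_map (μ := iidLaw Q) hmp.measurable.aemeasurable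
        (f := fun e => f e 0 ^ 2) ((h.measurable_field 0).pow_const 2).aestronglyMeasurable
      rw [hmp.map_eq] at this
      simp_rw [div_pow]
      rw [integral_div, this, mul_one_div]
    simp only [key]
    exact ((summable_nat_add_iff 1).2 (Real.summable_one_div_nat_pow.2 one_lt_two)).mul_left _

end Bridge.ControlledField

/-! ### The shear: from the optimal action to bridges in an i.i.d. environment -/

namespace ShotNoise

open Config Bridge

variable (M : ShotNoise)

/-- The environments at times `1, 2, …`, seen from the line of slope `v`. -/
def sheared (v : ℝ) (ω : Config) : ℕ → Config := fun k => env (k + 1) (v * (k + 1)) ω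

lemma sum_Ico_int (n : ℕ) (F : ℤ → ℝ) :
    ∑ k ∈ Finset.Ico (0 : ℤ) n, F k = ∑ k ∈ Finset.range n, F k := by
  have : Finset.Ico (0 : ℤ) n = (Finset.range n).map Nat.castEmbedding := by
    ext k
    simp only [Finset.mem_Ico, Finset.mem_map, Finset.mem_range, Nat.castEmbedding_apply]
    constructor
    · rintro ⟨h1, h2⟩
      exact ⟨k.toNat, by omega, by omega⟩
    · rintro ⟨j, hj, rfl⟩
      omega
  rw [this, Finset.sum_map]
  rfl

lemma sum_Ioo_int (n : ℕ) (F : ℤ → ℝ) :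
    ∑ k ∈ Finset.Ioo (0 : ℤ) (n + 1 : ℕ), F k = ∑ k ∈ Finset.range n, F (k + 1) := by
  rw [← sum_Ico_int n fun k => F (k + 1)]
  refine Finset.sum_bij' (fun k _ => k - 1) (fun k _ => k + 1) ?_ ?_ ?_ ?_ ?_ <;>
    simp only [Finset.mem_Ico, Finset.mem_Ioo] <;> intros <;> first | omega | simp

variable {M} {ω : Config} {p v : ℝ}

/-- After a shear, the action becomes the cost of a bridge up to a boundary term. -/
lemma action_eq_cost (hω : Disjoint ω.points M.admissibleᶜ) (n : ℕ) {γ : ℤ → ℝ} (h0 : γ 0 = 0)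
    (hn : γ (n + 1 : ℕ) = v * (n + 1 : ℕ)) :
    M.action p ω 0 (n + 1 : ℕ) γ =
      cost M.field (n + 1) (sheared v ω) (fun k => γ k - v * k) + (v ^ 2 / 2 * (n + 1 : ℕ) +
        p * (M.field (env 0 0 ω) 0 - M.field (sheared v ω n) 0)) := by
  have hpot (k : ℕ) : M.field (sheared v ω k) (γ (k + 1 : ℕ) - v * (k + 1 : ℕ)) =
      M.potential ω (k + 1) (γ (k + 1)) := by
    rw [sheared, ← M.potential_eq_field hω]
    push_cast
    rw [sub_add_cancel]
  have hF0 : M.field (env 0 0 ω) 0 = M.potential ω 0 (γ 0) := by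
    rw [← M.potential_eq_field hω, h0, add_zero]
  have hFn : M.field (sheared v ω n) 0 = M.potential ω (n + 1 : ℕ) (γ (n + 1 : ℕ)) := by
    have := hpot n
    rw [hn, sub_self] at this
    rw [this]
    norm_cast
  have hkin : ∑ k ∈ Finset.range (n + 1), (γ ((k : ℤ) + 1) - γ k) ^ 2 =
      kinetic (n + 1) (fun k => γ k - v * k) + v ^ 2 * (n + 1 : ℕ) := by
    -- The cross term is linear in the increment, so it telescopes to the endpoint values of the
    -- sheared path, both 0.
    have h1 (k : ℕ) : (γ ((k : ℤ) + 1) - γ k) ^ 2 =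
        (γ (k + 1 : ℕ) - v * (k + 1 : ℕ) - (γ k - v * k)) ^ 2 +
          (2 * v * ((γ (k + 1 : ℕ) - v * (k + 1 : ℕ)) - (γ (k : ℕ) - v * (k : ℕ))) + v ^ 2) := by
      push_cast; ring
    simp only [h1]
    rw [Finset.sum_add_distrib, Finset.sum_add_distrib, ← Finset.mul_sum,
      Finset.sum_range_sub (fun k : ℕ => γ k - v * k), hn]
    simp [h0, kinetic, mul_comm]
  rw [action, sum_Ico_int, hkin, sum_Ioo_int, cost, Finset.sum_range_succ, hF0, hFn]
  simp only [hpot]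
  push_cast
  ring

/-- Shearing carries paths to bridges and back, while the correction depends only on the fixed
endpoints; minimisation therefore commutes with it. The cost counts the final potential fully and
the initial one not at all, hence the term with `p`. -/
lemma actionValues_eq_image (hω : Disjoint ω.points M.admissibleᶜ) (n : ℕ) :
    M.actionValues p ω 0 (n + 1 : ℕ) 0 (v * (n + 1 : ℕ)) =
      (fun c => c + (v ^ 2 / 2 * (n + 1 : ℕ) +
        p * (M.field (env 0 0 ω) 0 - M.field (sheared v ω n) 0))) ''
        costValues M.field (n + 1) (sheared v ω) := by
  ext a
  constructor
  · rintro ⟨γ, h0, hn, rfl⟩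
    exact ⟨_, ⟨fun k => γ k - v * k, by simp [h0], by simp only [hn, sub_self], rfl⟩,
      (action_eq_cost hω n h0 hn).symm⟩
  · rintro ⟨_, ⟨δ, h0, hn, rfl⟩, rfl⟩
    have h0' : (fun k : ℤ => δ k.toNat + v * k) 0 = 0 := by simp [h0]
    have hn' : (fun k : ℤ => δ k.toNat + v * k) (n + 1 : ℕ) = v * (n + 1 : ℕ) := by
      simp only [Int.toNat_natCast, hn, zero_add, Int.cast_natCast]
    refine ⟨fun k : ℤ => δ k.toNat + v * k, h0', hn', ?_⟩
    rw [action_eq_cost hω n h0' hn']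
    simp

variable {P : Measure Config}

lemma measurable_sheared (v : ℝ) : Measurable (sheared v) :=
  measurable_pi_lambda _ fun _ => measurable_env _ _

lemma isProbabilityMeasure_map_restrict (hP : IsPoissonLaw M.drivingMeasure P) :
    IsProbabilityMeasure (P.map (restrict (timeSlice 0))) :=
  have := hP.isProbabilityMeasure
  Measure.isProbabilityMeasure_map (measurable_restrict (measurableSet_timeSlice 0)).aemeasurable

lemma exists_controlledField (hP : IsPoissonLaw M.drivingMeasure P) :
    ∃ g, ControlledField (P.map (restrict (timeSlice 0))) M.field g := by
  obtain ⟨c, -, hc⟩ := M.exists_abs_field_le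
  exact ⟨fun e i => c * count (M.cell i) e,
    { measurable_field := M.measurable_field
      continuous_field := M.continuous_field
      measurable_bound := fun i => ((measurable_of_countable (Nat.cast : ℕ → ℝ)).comp
        (M.measurable_count_cell i)).const_mul c
      abs_le := hc
      exp_moment := exists_lintegral_exp_count_cell_le hP c }⟩

/-- Distinct times give independent slices and every slice has the same law wherever it is viewed
from. The target law is free of `v`, which yields the quadratic form of the shape function. -/
lemma measurePreserving_sheared (hP : IsPoissonLaw M.drivingMeasure P)
    [IsProbabilityMeasure (P.map (restrict (timeSlice 0)))] (v : ℝ) :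
    MeasurePreserving (sheared v) P (iidLaw (P.map (restrict (timeSlice 0)))) := by
  have := hP.isProbabilityMeasure
  refine ⟨measurable_sheared v, ?_⟩
  have hind : iIndepFun (fun (k : ℕ) ω => env (k + 1) (v * (k + 1)) ω) P :=
    iIndepFun_env hP (t := fun k : ℕ => (k : ℤ) + 1) (fun i j h => by simpa using h)
      (fun k => v * (k + 1))
  have h := hind.map_fun_eq_infinitePi_map (fun k => measurable_env _ _)
  simp only [map_env hP] at h
  exact h

lemma measurePreserving_env (hP : IsPoissonLaw M.drivingMeasure P) (k : ℤ) (a : ℝ) :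
    MeasurePreserving (env k a) P (P.map (restrict (timeSlice 0))) :=
  ⟨measurable_env k a, map_env hP k a⟩

lemma integral_comp_env (hP : IsPoissonLaw M.drivingMeasure P) {F : Config → ℝ}
    (hF : Measurable F) (k : ℤ) (a : ℝ) :
    ∫ ω, F (env k a ω) ∂P = ∫ e, F e ∂(P.map (restrict (timeSlice 0))) := by
  rw [← map_env hP k a, integral_map (measurable_env k a).aemeasurable hF.aestronglyMeasurable]

section law

variable [IsProbabilityMeasure (P.map (restrict (timeSlice 0)))] {g : Config → ℤ → ℝ}

lemma ae_optimalAction (hP : IsPoissonLaw M.drivingMeasure P)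
    (h : ControlledField (P.map (restrict (timeSlice 0))) M.field g) (p v : ℝ) :
    ∀ᵐ ω ∂P, ∀ n : ℕ, IsLeast (M.actionValues p ω 0 (n + 1 : ℕ) 0 (v * (n + 1 : ℕ)))
        (M.optimalAction p ω 0 (n + 1 : ℕ) 0 (v * (n + 1 : ℕ))) ∧
      M.optimalAction p ω 0 (n + 1 : ℕ) 0 (v * (n + 1 : ℕ)) =
        minCost M.field (n + 1) (sheared v ω) + (v ^ 2 / 2 * (n + 1 : ℕ) +
          p * (M.field (env 0 0 ω) 0 - M.field (sheared v ω n) 0)) := by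
  filter_upwards [hP.ae_disjoint M.measurableSet_admissible.compl M.drivingMeasure_compl_admissible,
    (measurePreserving_sheared hP v).quasiMeasurePreserving.ae h.ae_isLeast] with ω hω hleast n
  have h1 : IsLeast (costValues M.field (n + 1) (sheared v ω))
      (minCost M.field (n + 1) (sheared v ω)) := by
    simpa using hleast 0 (n + 1)
  have h2 : IsLeast (M.actionValues p ω 0 (n + 1 : ℕ) 0 (v * (n + 1 : ℕ)))
      (minCost M.field (n + 1) (sheared v ω) + (v ^ 2 / 2 * (n + 1 : ℕ) +
          p * (M.field (env 0 0 ω) 0 - M.field (sheared v ω n) 0))) := by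
    rw [actionValues_eq_image hω n]
    exact ⟨⟨_, h1.1, rfl⟩, by rintro _ ⟨c, hc, rfl⟩; dsimp only; gcongr; exact h1.2 hc⟩
  have h3 : M.optimalAction p ω 0 (n + 1 : ℕ) 0 (v * (n + 1 : ℕ)) = _ := h2.csInf_eq
  rw [h3]
  exact ⟨h2, rfl⟩

lemma integrable_field_env (hP : IsPoissonLaw M.drivingMeasure P)
    (h : ControlledField (P.map (restrict (timeSlice 0))) M.field g) (k : ℤ) (a : ℝ) :
    Integrable (fun ω => M.field (env k a ω) 0) P :=
  (measurePreserving_env hP k a).integrable_comp_of_integrable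
    (h.memLp_field.integrable one_le_two)

lemma integral_comp_sheared (hP : IsPoissonLaw M.drivingMeasure P) {F : (ℕ → Config) → ℝ}
    (hF : Measurable F) (v : ℝ) :
    ∫ ω, F (sheared v ω) ∂P = ∫ y, F y ∂(iidLaw (P.map (restrict (timeSlice 0)))) := by
  rw [← (measurePreserving_sheared hP v).map_eq,
    integral_map (measurable_sheared v).aemeasurable hF.aestronglyMeasurable]

lemma integrable_minCost_sheared (hP : IsPoissonLaw M.drivingMeasure P)
    (h : ControlledField (P.map (restrict (timeSlice 0))) M.field g) (v : ℝ) (n : ℕ) :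
    Integrable (fun ω => minCost M.field n (sheared v ω)) P := by
  obtain ⟨C, hC⟩ := h.exists_drift
  exact (measurePreserving_sheared hP v).integrable_comp_of_integrable (h.integrable_minCost hC n)

lemma integrable_boundary (hP : IsPoissonLaw M.drivingMeasure P)
    (h : ControlledField (P.map (restrict (timeSlice 0))) M.field g) (p v : ℝ) (n : ℕ) :
    Integrable (fun ω => p * (M.field (env 0 0 ω) 0 - M.field (sheared v ω n) 0)) P :=
  ((integrable_field_env hP h 0 0).sub (integrable_field_env hP h _ _)).const_mul p

lemma integrable_shear_term (hP : IsPoissonLaw M.drivingMeasure P)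
    (h : ControlledField (P.map (restrict (timeSlice 0))) M.field g) (p v : ℝ) (n : ℕ) :
    Integrable (fun ω => v ^ 2 / 2 * (n + 1 : ℕ) +
      p * (M.field (env 0 0 ω) 0 - M.field (sheared v ω n) 0)) P :=
  have := hP.isProbabilityMeasure
  (integrable_const _).add (integrable_boundary hP h p v n)

lemma integrable_optimalAction (hP : IsPoissonLaw M.drivingMeasure P)
    (h : ControlledField (P.map (restrict (timeSlice 0))) M.field g) (p v : ℝ) (n : ℕ) :
    Integrable (fun ω => M.optimalAction p ω 0 (n + 1 : ℕ) 0 (v * (n + 1 : ℕ))) P := by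
  have := hP.isProbabilityMeasure
  refine ((integrable_minCost_sheared hP h v (n + 1)).add
    (integrable_shear_term hP h p v n)).congr ?_
  filter_upwards [ae_optimalAction hP h p v] with ω hω
  exact (hω n).2.symm

/-- The expected optimal action: the boundary terms cancel and the shear costs `v ^ 2 / 2` per
unit time. -/
lemma integral_optimalAction (hP : IsPoissonLaw M.drivingMeasure P)
    (h : ControlledField (P.map (restrict (timeSlice 0))) M.field g) (p v : ℝ) (n : ℕ) :
    ∫ ω, M.optimalAction p ω 0 (n + 1 : ℕ) 0 (v * (n + 1 : ℕ)) ∂P =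
      ∫ y, minCost M.field (n + 1) y ∂(iidLaw (P.map (restrict (timeSlice 0)))) +
        v ^ 2 / 2 * (n + 1 : ℕ) := by
  have := hP.isProbabilityMeasure
  have hF := M.measurable_field 0
  rw [integral_congr_ae ((ae_optimalAction hP h p v).mono fun ω hω => (hω n).2),
    integral_add (integrable_minCost_sheared hP h v (n + 1))
      (integrable_shear_term hP h p v n),
    integral_add (integrable_const _) (integrable_boundary hP h p v n), integral_const,
    integral_const_mul p, integral_sub (integrable_field_env hP h 0 0)
      (f := fun ω => M.field (env 0 0 ω) 0) (g := fun ω => M.field (sheared v ω n) 0)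
      (integrable_field_env hP h _ _),
    integral_comp_env hP hF, integral_comp_sheared hP (h.measurable_minCost (n + 1))]
  have h1 : ∫ ω, M.field (sheared v ω n) 0 ∂P =
      ∫ e, M.field e 0 ∂(P.map (restrict (timeSlice 0))) := integral_comp_env hP hF _ _
  rw [h1]
  simp

lemma integral_optimalAction_div (hP : IsPoissonLaw M.drivingMeasure P)
    (h : ControlledField (P.map (restrict (timeSlice 0))) M.field g) (p v : ℝ) (n : ℕ+) :
    (∫ ω, M.optimalAction p ω 0 (n : ℕ) 0 (v * (n : ℕ)) ∂P) / (n : ℕ) =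
      (∫ y, minCost M.field n y ∂(iidLaw (P.map (restrict (timeSlice 0))))) / (n : ℕ) +
        v ^ 2 / 2 := by
  obtain ⟨m, hm⟩ : ∃ m : ℕ, (n : ℕ) = m + 1 := ⟨n - 1, (Nat.succ_pred_eq_of_pos n.pos).symm⟩
  have hpos : ((m + 1 : ℕ) : ℝ) ≠ 0 := by positivity
  rw [hm, integral_optimalAction hP h, add_div, mul_div_cancel_right₀ _ hpos]

lemma bddBelow_integral_minCost_div
    (h : ControlledField (P.map (restrict (timeSlice 0))) M.field g) :
    BddBelow (Set.range fun n : ℕ+ =>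
      (∫ y, minCost M.field n y ∂(iidLaw (P.map (restrict (timeSlice 0))))) / (n : ℕ)) := by
  obtain ⟨C, hC⟩ := h.exists_drift
  refine (h.bddBelow_integral_div hC).mono ?_
  rintro _ ⟨n, rfl⟩
  exact ⟨n, rfl⟩

lemma shapeFunction_eq (hP : IsPoissonLaw M.drivingMeasure P)
    (h : ControlledField (P.map (restrict (timeSlice 0))) M.field g) (p v : ℝ) :
    M.shapeFunction P p v =
      growthRate (P.map (restrict (timeSlice 0))) M.field + v ^ 2 / 2 := by
  rw [shapeFunction, growthRate, ciInf_add (bddBelow_integral_minCost_div h)]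
  simp only [integral_optimalAction_div hP h]

lemma ae_tendsto_optimalAction_div (hP : IsPoissonLaw M.drivingMeasure P)
    (h : ControlledField (P.map (restrict (timeSlice 0))) M.field g) (p v : ℝ) :
    ∀ᵐ ω ∂P, Tendsto (fun n : ℕ => M.optimalAction p ω 0 n 0 (v * n) / n) atTop
      (𝓝 (M.shapeFunction P p v)) := by
  have hmp := measurePreserving_sheared hP v
  filter_upwards [ae_optimalAction hP h p v,
    hmp.quasiMeasurePreserving.ae h.ae_tendsto_minCost_div,
    hmp.quasiMeasurePreserving.ae h.ae_tendsto_field_div] with ω hω h1 h2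
  -- The identity with the bridge cost is available for lengths `n + 1` only, so the sequence is
  -- shifted by one.
  rw [shapeFunction_eq hP h, ← tendsto_add_atTop_iff_nat 1]
  have h3 : Tendsto (fun n : ℕ => M.field (env 0 0 ω) 0 / ((n + 1 : ℕ) : ℝ)) atTop (𝓝 0) :=
    (tendsto_add_atTop_iff_nat 1).2 (tendsto_const_div_atTop_nhds_zero_nat _)
  have h4 := (((tendsto_add_atTop_iff_nat 1).2 h1).add_const (v ^ 2 / 2)).add
    ((h3.sub h2).const_mul p)
  rw [sub_zero, mul_zero, add_zero] at h4
  refine h4.congr fun n => ?_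
  have hpos : ((n + 1 : ℕ) : ℝ) ≠ 0 := by positivity
  rw [(hω n).2]
  field_simp
  ring

lemma tendsto_eLpNorm_optimalAction_div (hP : IsPoissonLaw M.drivingMeasure P)
    (h : ControlledField (P.map (restrict (timeSlice 0))) M.field g) (p v : ℝ) :
    Tendsto (fun n : ℕ => eLpNorm (fun ω => M.optimalAction p ω 0 n 0 (v * n) / n -
      M.shapeFunction P p v) 1 P) atTop (𝓝 0) := by
  have := hP.isProbabilityMeasure
  obtain ⟨C, hC⟩ := h.exists_drift
  let I : ℝ := ∫ e, |M.field e 0| ∂(P.map (restrict (timeSlice 0)))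
  let D : ℕ → ℝ := fun n => ∫ y, |minCost M.field n y / n -
    growthRate (P.map (restrict (timeSlice 0))) M.field| ∂(iidLaw (P.map (restrict (timeSlice 0))))
  have hF := M.measurable_field 0
  rw [← tendsto_add_atTop_iff_nat 1]
  -- `D` is the bridge error in mean; the two endpoint potentials each have mean absolute value `I`,
  -- whence the factor 2.
  have hlim : Tendsto (fun n : ℕ => ENNReal.ofReal (D (n + 1) + 2 * |p| * I / ((n + 1 : ℕ) : ℝ)))
      atTop (𝓝 0) := by
    have h1 := ((tendsto_add_atTop_iff_nat 1).2 h.tendsto_integral_abs_minCost_div_sub).add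
      ((tendsto_add_atTop_iff_nat 1).2 (tendsto_const_div_atTop_nhds_zero_nat (2 * |p| * I)))
    rw [add_zero] at h1
    rw [← ENNReal.ofReal_zero]
    exact ENNReal.tendsto_ofReal h1
  refine tendsto_of_tendsto_of_tendsto_of_le_of_le tendsto_const_nhds hlim (fun _ => zero_le)
    fun n => ?_
  have hint : Integrable (fun ω => M.optimalAction p ω 0 (n + 1 : ℕ) 0 (v * (n + 1 : ℕ)) /
      ((n + 1 : ℕ) : ℝ) - M.shapeFunction P p v) P :=
    ((integrable_optimalAction hP h p v n).div_const _).sub (integrable_const _)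
  have hd : Integrable (fun ω => |minCost M.field (n + 1) (sheared v ω) / ((n + 1 : ℕ) : ℝ) -
      growthRate (P.map (restrict (timeSlice 0))) M.field|) P :=
    (((integrable_minCost_sheared hP h v (n + 1)).div_const _).sub (integrable_const _)).abs
  have hb0 := (integrable_field_env hP h 0 0).abs
  have hb1 : Integrable (fun ω => |M.field (sheared v ω n) 0|) P :=
    (integrable_field_env hP h _ _).abs
  have hb : Integrable (fun ω => |p| / ((n + 1 : ℕ) : ℝ) *
      (|M.field (env 0 0 ω) 0| + |M.field (sheared v ω n) 0|)) P := (hb0.add hb1).const_mul _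
  have e1 : ∫ ω, |M.field (sheared v ω n) 0| ∂P = I := integral_comp_env hP hF.abs _ _
  have e0 : ∫ ω, |M.field (env 0 0 ω) 0| ∂P = I := integral_comp_env hP hF.abs _ _
  have e2 : ∫ ω, |minCost M.field (n + 1) (sheared v ω) / ((n + 1 : ℕ) : ℝ) -
      growthRate (P.map (restrict (timeSlice 0))) M.field| ∂P = D (n + 1) :=
    integral_comp_sheared hP (((h.measurable_minCost (n + 1)).div_const _).sub_const _).abs v
  rw [eLpNorm_one_eq_lintegral_enorm, ← ofReal_integral_norm_eq_lintegral_enorm hint]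
  refine ENNReal.ofReal_le_ofReal ?_
  calc _ ≤ ∫ ω, (|minCost M.field (n + 1) (sheared v ω) / ((n + 1 : ℕ) : ℝ) -
      growthRate (P.map (restrict (timeSlice 0))) M.field| + |p| / ((n + 1 : ℕ) : ℝ) *
      (|M.field (env 0 0 ω) 0| + |M.field (sheared v ω n) 0|)) ∂P := by
        refine integral_mono_ae hint.norm (hd.add hb) ?_
        filter_upwards [ae_optimalAction hP h p v] with ω hω
        have hpos : ((n + 1 : ℕ) : ℝ) ≠ 0 := by positivity
        rw [(hω n).2, shapeFunction_eq hP h, Real.norm_eq_abs]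
        have e3 : (minCost M.field (n + 1) (sheared v ω) + (v ^ 2 / 2 * (n + 1 : ℕ) +
            p * (M.field (env 0 0 ω) 0 - M.field (sheared v ω n) 0))) / ((n + 1 : ℕ) : ℝ) -
            (growthRate (P.map (restrict (timeSlice 0))) M.field + v ^ 2 / 2) =
            (minCost M.field (n + 1) (sheared v ω) / ((n + 1 : ℕ) : ℝ) -
              growthRate (P.map (restrict (timeSlice 0))) M.field) + p / ((n + 1 : ℕ) : ℝ) *
              (M.field (env 0 0 ω) 0 - M.field (sheared v ω n) 0) := by
          field_simp
          ring
        rw [e3]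
        refine (abs_add_le _ _).trans ?_
        gcongr
        rw [abs_mul, abs_div, Nat.abs_cast]
        gcongr
        exact abs_sub _ _
    _ = _ := by
        rw [integral_add hd hb, integral_const_mul, integral_add hb0 hb1, e0, e1, e2]
        ring

end law

end ShotNoise

end

theorem mainTheorem6 (M : ShotNoise) (P : Measure Config)
    (hP : IsPoissonLaw M.drivingMeasure P) :
    (∀ p ∈ Set.Icc (0 : ℝ) 1, ∀ v : ℝ,
      -- the optimal actions are almost surely minima, with finite expectation
      (∀ n : ℕ, 1 ≤ n →
        (∀ᵐ ω ∂P, IsLeast (M.actionValues p ω 0 n 0 (v * n))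
          (M.optimalAction p ω 0 n 0 (v * n))) ∧
        Integrable (fun ω => M.optimalAction p ω 0 n 0 (v * n)) P) ∧
      -- the infimum defining the shape function is finite
      BddBelow (Set.range fun n : ℕ+ =>
        (∫ ω, M.optimalAction p ω 0 (n : ℕ) 0 (v * (n : ℕ)) ∂P) / (n : ℕ)) ∧
      -- almost sure convergence
      (∀ᵐ ω ∂P, Tendsto (fun n : ℕ => M.optimalAction p ω 0 n 0 (v * n) / n) atTop
        (𝓝 (M.shapeFunction P p v))) ∧
      -- convergence in L¹
      Tendsto (fun n : ℕ => eLpNorm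
        (fun ω => M.optimalAction p ω 0 n 0 (v * n) / n - M.shapeFunction P p v) 1 P) atTop
        (𝓝 0) ∧
      M.shapeFunction P p v = M.shapeFunction P p 0 + v ^ 2 / 2) ∧
    (∀ p ∈ Set.Icc (0 : ℝ) 1, ∀ q ∈ Set.Icc (0 : ℝ) 1, ∀ v : ℝ,
      M.shapeFunction P p v = M.shapeFunction P q v) := by
  have := ShotNoise.isProbabilityMeasure_map_restrict hP
  obtain ⟨g, h⟩ := ShotNoise.exists_controlledField hP
  refine ⟨fun p _ v => ⟨fun n hn => ?_, ?_, ShotNoise.ae_tendsto_optimalAction_div hP h p v,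
    ShotNoise.tendsto_eLpNorm_optimalAction_div hP h p v, ?_⟩, fun p _ q _ v => ?_⟩
  · obtain ⟨m, rfl⟩ : ∃ m, n = m + 1 := ⟨n - 1, by omega⟩
    exact ⟨(ShotNoise.ae_optimalAction hP h p v).mono fun ω hω => (hω m).1,
      ShotNoise.integrable_optimalAction hP h p v m⟩
  · simp only [ShotNoise.integral_optimalAction_div hP h]
    obtain ⟨b, hb⟩ := ShotNoise.bddBelow_integral_minCost_div h
    refine ⟨b + v ^ 2 / 2, ?_⟩
    rintro _ ⟨n, rfl⟩
    exact add_le_add_left (hb ⟨n, rfl⟩) _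
  · rw [ShotNoise.shapeFunction_eq hP h, ShotNoise.shapeFunction_eq hP h]
    ring
  · rw [ShotNoise.shapeFunction_eq hP h, ShotNoise.shapeFunction_eq hP h]
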